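/- All structures are relational, non-empty and at most countable. Let $k,\ell\ge 1$, let $\mathbb B$ be a homogeneous, $k$-homogeneous, $\ell$-bounded model-complete core, and let $\mathbb A$ be a first-order expansion of $\mathbb B$ with finite signature. If $\mathbb A$ is unbalanced and equality-free, then $\mathbb A$ has finite duality. Here the following terminology is used. *Structures.* $\mathbb B$ is *homogeneous* if every isomorphism between finite substructures of $\mathbb B$ extends to an automorphism. It is *$k$-homogeneous* if two tuples of the same finite length lie in the same orbit of $\mathrm{Aut}(\mathbb B)$ whenever all their corresponding $k$-subtuples (repeated indices allowed) do. It is *$\ell$-bounded* if every finite structure $\mathbb X$ all of whose substructures with at most $\ell$ elements embed into $\mathbb B$ embeds into $\mathbb B$ itself. It is a *model-complete core* if for every endomorphism $e$ of $\mathbb B$ and every finite set $S$ of elements some automorphism agrees with $e$ on $S$. A *first-order expansion* of $\mathbb B$ is an expansion of $\mathbb B$ by relations that are first-order definable in $\mathbb B$ without parameters. *Formulas.* An *$\mathbb A$-formula* is a formula built by conjunctions and existential quantifiers from atoms $R(x_1,\dots,x_n)$ with $R$ in the signature of $\mathbb A$ (no equality atoms). $\mathrm{Var}(\phi)$ is the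 set of its free variables, $\phi^{\mathbb A}$ is the set of its satisfying assignments $\mathrm{Var}(\phi)\to A$, and $\mathrm{proj}_{\bar u}(\phi^{\mathbb A})=\{f(\bar u): f\in\phi^{\mathbb A}\}$. A relation is *$\mathbb A$-definable* if it is $\mathrm{proj}_{\bar u}(\phi^{\mathbb A})$ for an $\mathbb A$-formula $\phi$ and a tuple $\bar u$ of pairwise different free variables of $\phi$. $\mathbb A$ is *equality-free* if the relation $\{(a,a):a\in A\}$ is not $\mathbb A$-definable. *Implications.* Let $C\subseteq A^m$ and $D\subseteq A^n$ be non-empty and $\mathbb A$-definable, let $\phi$ be an $\mathbb A$-formula, and let $\bar u$, $\bar v$ be tuples of length $m$, $n$, each consisting of pairwise different free variables of $\phi$. Then $\phi$ is a *$(C,\bar u,D,\bar v)$-implication* in $\mathbb A$ if $C\subsetneq \mathrm{proj}_{\bar u}(\phi^{\mathbb A})$, $D\subsetneq \mathrm{proj}_{\bar v}(\phi^{\mathbb A})$, every $f\in\phi^{\mathbb A}$ with $f(\bar u)\in C$ satisfies $f(\bar v)\in D$, and every $\bar a\in D$ equals $f(\bar v)$ for some $f\in\phi^{\mathbb A}$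 with $f(\bar u)\in C$. It is *balanced* if $C=D$ and $\mathrm{proj}_{\bar u}(\phi^{\mathbb A})=\mathrm{proj}_{\bar v}(\phi^{\mathbb A})$. It is *proper* if $\phi^{\mathbb A}$, the set of assignments with $\bar u\in C$, and the set of assignments with $\bar v\in D$ have the same projection to the variables common to $\bar u$ and $\bar v$. It is *stable* if some entry of $\bar u$ does not occur in $\bar v$, some entry of $\bar v$ does not occur in $\bar u$, and $u_i=v_j$ implies $i=j$. $\mathbb A$ is *unbalanced* if there is no stable, balanced and proper implication in $\mathbb A$. *Finite duality.* $\mathbb A$ has *finite duality* if there is a finite set $\mathcal O$ of finite structures in the signature of $\mathbb A$ such that every finite structure $\mathbb C$ in this signature maps homomorphically to $\mathbb A$ if and only if no $\mathbb D\in\mathcal O$ maps homomorphically to $\mathbb C$. -/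

import Mathlib

open FirstOrder

namespace FiniteDuality

universe u v u' v' w

section Structures

variable (L : FirstOrder.Language.{u, v}) (M : Type w) [L.Structure M]

/-- Two tuples of elements of `M` lie in the same orbit under the automorphism group of `M`. -/
def SameOrbit {n : ℕ} (a b : Fin n → M) : Prop :=
  ∃ g : M ≃[L] M, ∀ i, g (a i) = b i

/-- `M` is `k`-homogeneous: two tuples of the same finite length are in the same orbit as soon as
all their corresponding `k`-subtuples are. Subtuples may repeat indices, so that tuples shorter
than `k` are treated correctly. -/
def IsKHomogeneous (k : ℕ) : Prop :=
  ∀ (n : ℕ) (a b : Fin n → M),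
    (∀ i : Fin k → Fin n, SameOrbit L M (a ∘ i) (b ∘ i)) → SameOrbit L M a b

/-- `M` is `ℓ`-bounded: a finite structure embeds into `M` as soon as all its substructures
with at most `ℓ` elements do. -/
def IsLBounded (ℓ : ℕ) : Prop :=
  ∀ (X : Type) [Finite X] [L.Structure X],
    (∀ Y : L.Substructure X, Nat.card Y ≤ ℓ → Nonempty (Y ↪[L] M)) → Nonempty (X ↪[L] M)

/-- `M` is a model-complete core: every endomorphism agrees on every finite set with some
automorphism. -/
def IsModelCompleteCore : Prop :=
  ∀ (e : M →[L] M) (S : Finset M), ∃ g : M ≃[L] M, ∀ x ∈ S, g x = e x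

/-- `O` is an obstruction set for `M`: a finite structure maps homomorphically to `M` if and only
if no member of `O` maps homomorphically to it. Finite structures in `O` are taken, up to
isomorphism, on the domains `Fin n`. -/
def IsObstructionSet (O : Set (Σ n : ℕ, L.Structure (Fin n))) : Prop :=
  ∀ (C : Type) [Finite C] [L.Structure C],
    Nonempty (C →[L] M) ↔ ∀ D ∈ O, ¬ Nonempty (@FirstOrder.Language.Hom L (Fin D.1) C D.2 _)

/-- `M` has finite duality: it has a finite obstruction set. -/
def HasFiniteDuality : Prop :=
  ∃ O : Set (Σ n : ℕ, L.Structure (Fin n)), O.Finite ∧ IsObstructionSet L M O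

end Structures

/-- The `L'`-structure `M` is a first-order expansion of the `L`-structure `M`, where `ι` is the
inclusion of the signatures: `ι` is injective, the symbols of `L` keep their meaning, and every
relation of `L'` is first-order definable, without parameters, in the `L`-structure. -/
structure IsFirstOrderExpansion {L : FirstOrder.Language.{u, v}} {L' : FirstOrder.Language.{u', v'}}
    (ι : L →ᴸ L') (M : Type w) [L.Structure M] [L'.Structure M] : Prop where
  injective : ι.Injective
  isExpansionOn : ι.IsExpansionOn M
  definable : ∀ (n : ℕ) (R : L'.Relations n),
    (∅ : Set M).Definable L {a : Fin n → M | FirstOrder.Language.Structure.RelMap R a}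

section Formulas

variable {L : FirstOrder.Language.{u, v}}

/-- The formulas built only from atoms `R(x₁, …, xₙ)`, with `R` a relation symbol of the
signature, by conjunctions and existential quantifiers. Equality atoms are not allowed. -/
inductive IsAFormula {α : Type} : ∀ {n : ℕ}, L.BoundedFormula α n → Prop
  | rel {n l : ℕ} (R : L.Relations l)
      (ts : Fin l → L.Term (α ⊕ Fin n)) :
      IsAFormula (FirstOrder.Language.BoundedFormula.rel R ts)
  | inf {n : ℕ} {φ ψ : L.BoundedFormula α n} :
      IsAFormula φ → IsAFormula ψ → IsAFormula (φ ⊓ ψ)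
  | ex {n : ℕ} {φ : L.BoundedFormula α (n + 1)} : IsAFormula φ → IsAFormula φ.ex

variable (M : Type w) [L.Structure M]

/-- The satisfying assignments of a formula whose free variables are among the natural numbers.
Assignments are total; the values outside the free variables are irrelevant. -/
def sols (φ : L.Formula ℕ) : Set (ℕ → M) := {f | φ.Realize f}

variable {M}

/-- The projection `{f(u) : f ∈ F}` of a set of assignments to a tuple `u` of variables. -/
def proj {n : ℕ} (u : Fin n → ℕ) (F : Set (ℕ → M)) : Set (Fin n → M) := (fun f => f ∘ u) '' F

/-- The projection of a set of assignments to a set of variables. -/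
def projOn (Z : Set ℕ) (F : Set (ℕ → M)) : Set (Z → M) := Z.domRestrict '' F

/-- `R` is definable by a primitive positive formula without equality atoms: it is the relation
`{f(u) : f satisfies φ}` for such a formula `φ` and a tuple `u` of pairwise different free
variables of `φ`. -/
def IsADefinable (L : FirstOrder.Language.{u, v}) {M : Type w} [L.Structure M] {n : ℕ}
    (R : Set (Fin n → M)) : Prop :=
  ∃ (φ : L.Formula ℕ) (u : Fin n → ℕ), IsAFormula φ ∧ Function.Injective u ∧
    (∀ i, u i ∈ φ.freeVarFinset) ∧ R = proj u (sols M φ)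

/-- `φ` is a `(C, u, D, v)`-implication in `M`. -/
structure IsImplication {k l : ℕ} (φ : L.Formula ℕ) (C : Set (Fin k → M)) (u : Fin k → ℕ)
    (D : Set (Fin l → M)) (v : Fin l → ℕ) : Prop where
  isAFormula : IsAFormula φ
  definable_left : IsADefinable L C
  definable_right : IsADefinable L D
  nonempty_left : C.Nonempty
  nonempty_right : D.Nonempty
  injective_left : Function.Injective u
  injective_right : Function.Injective v
  free_left : ∀ i, u i ∈ φ.freeVarFinset
  free_right : ∀ i, v i ∈ φ.freeVarFinset
  ssubset_left : C ⊂ proj u (sols M φ)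
  ssubset_right : D ⊂ proj v (sols M φ)
  imp : ∀ f ∈ sols M φ, f ∘ u ∈ C → f ∘ v ∈ D
  onto : ∀ a ∈ D, ∃ f ∈ sols M φ, f ∘ u ∈ C ∧ f ∘ v = a

/-- Properness: on the variables common to `u` and `v`, the projections of `φ`, of `C(u)` and of
`D(v)` coincide. -/
def IsProper {k l : ℕ} (φ : L.Formula ℕ) (C : Set (Fin k → M)) (u : Fin k → ℕ)
    (D : Set (Fin l → M)) (v : Fin l → ℕ) : Prop :=
  projOn (Set.range u ∩ Set.range v) (sols M φ) =
      projOn (Set.range u ∩ Set.range v) {f : ℕ → M | f ∘ u ∈ C} ∧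
    projOn (Set.range u ∩ Set.range v) {f : ℕ → M | f ∘ u ∈ C} =
      projOn (Set.range u ∩ Set.range v) {f : ℕ → M | f ∘ v ∈ D}

/-- Balancedness: the pairs `(C, proj_u φ)` and `(D, proj_v φ)` are equal. As `C` and `D` are
non-empty, this forces the two tuples to have the same length. -/
def IsBalanced {k : ℕ} (φ : L.Formula ℕ) (C : Set (Fin k → M)) (u : Fin k → ℕ)
    (D : Set (Fin k → M)) (v : Fin k → ℕ) : Prop :=
  C = D ∧ proj u (sols M φ) = proj v (sols M φ)

/-- Nontriviality: neither the partial function `{(i, j) : u i = v j}` nor its inverse is total. -/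
def IsNontrivial {k l : ℕ} (u : Fin k → ℕ) (v : Fin l → ℕ) : Prop :=
  (¬ ∀ i, ∃ j, u i = v j) ∧ (¬ ∀ j, ∃ i, u i = v j)

/-- Stability: nontrivial, and the partial function `{(i, j) : u i = v j}` is the identity on its
domain. -/
def IsStable {k l : ℕ} (u : Fin k → ℕ) (v : Fin l → ℕ) : Prop :=
  IsNontrivial u v ∧ ∀ i j, u i = v j → (i : ℕ) = (j : ℕ)

end Formulas

/-- `M` is unbalanced: it has no stable, balanced and proper implication. -/
def IsUnbalanced (L : FirstOrder.Language.{u, v}) (M : Type w) [L.Structure M] : Prop :=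
  ¬ ∃ (k : ℕ) (φ : L.Formula ℕ) (C D : Set (Fin k → M)) (u v : Fin k → ℕ),
    IsImplication φ C u D v ∧ IsStable u v ∧ IsBalanced φ C u D v ∧ IsProper φ C u D v

/-- `M` is equality-free: the equality relation has no primitive positive definition without
equality atoms. -/
def IsEqualityFree (L : FirstOrder.Language.{u, v}) (M : Type w) [L.Structure M] : Prop :=
  ¬ IsADefinable L {a : Fin 2 → M | a 0 = a 1}

end FiniteDuality

/-! The obstructions are the structures with at most `N` elements that do not map to `M`, so the
task is to find `N` such that a finite `V` maps to `M` as soon as all its parts of size at most `N`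
do. The elements of `V` are treated as variables, and local solvability is strengthened one arity at
a time: level `m` means that all sets of at most `m` variables carry minimal non-empty definable
constraints that are jointly solvable on every set of at most `K` variables. Each level is bought by
a larger number of variables at the level below (`HasLevel.succ_of_le`).

The passage to arity `n` studies pairs `C ⊂ W` of definable `n`-ary relations and the steps that a
definable relation induces from one pair to another. As the constraints of lower arity are minimal,
`C` and `W` have equal projections to fewer than `n` coordinates. A chain of steps returning to such
a pair composes to a stable, balanced and proper implication, so it does not exist
(`IsUnbalanced.not_step`). By homogeneity there are only finitely many definable `n`-ary relations,
hence chains have bounded length. This is used twice: a contradiction derived along a tree of bags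
needs only a tree of bounded height, thus boundedly many variables (`BagTree.eval_nonempty`), and a
minimal consistent family of `n`-ary constraints consists of minimal relations
(`exists_isConsistent_minDef`).

At level `max k 2`, the core property puts each constraint inside one orbit (`exists_aut_of_mem`),
and by `k`-homogeneity the local solutions on a set of variables are unique up to automorphisms.
They define an `L`-structure on a quotient of `V`, which embeds into `M` by `ℓ`-boundedness. On each
related tuple this embedding lies in the orbit of a local solution, so it respects the relations of
the expansion (`HasLevel.nonempty_hom`). -/

namespace FiniteDuality

open Function Set

universe u v w

/-! ### Finite sets of atoms and the relations they define -/

section ConjunctiveQueries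

variable (L : FirstOrder.Language.{u, v})

/-- An atomic relational formula with variables in `X`. -/
structure Atom (X : Type*) where
  /-- The arity of the relation symbol. -/
  arity : ℕ
  /-- The relation symbol. -/
  rel : L.Relations arity
  /-- The variables to which the relation symbol is applied. -/
  args : Fin arity → X

variable {L}

namespace Atom

/-- Renaming of the variables of an atom. -/
def map {X Y : Type*} (ρ : X → Y) (a : Atom L X) : Atom L Y := ⟨a.arity, a.rel, ρ ∘ a.args⟩

/-- The atom `a` holds in `M` under the assignment `f`. -/
def Holds {X : Type*} {M : Type w} [L.Structure M] (a : Atom L X) (f : X → M) : Prop :=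
  FirstOrder.Language.Structure.RelMap a.rel (f ∘ a.args)

end Atom

/-- The assignment `f` satisfies all atoms in `S`. -/
def Models {X : Type*} {M : Type w} [L.Structure M] (S : Set (Atom L X)) (f : X → M) : Prop :=
  ∀ a ∈ S, a.Holds f

/-- The variable `x` occurs in some atom of `S`. -/
def Occurs {X : Type*} (S : Set (Atom L X)) (x : X) : Prop := ∃ a ∈ S, x ∈ range a.args

variable {M : Type w} [L.Structure M]

theorem models_union {X : Type*} {S T : Set (Atom L X)} {f : X → M} :
    Models (S ∪ T) f ↔ Models S f ∧ Models T f := by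
  constructor
  · intro h
    exact ⟨fun a ha => h a (Or.inl ha), fun a ha => h a (Or.inr ha)⟩
  · rintro ⟨h1, h2⟩ a (ha | ha)
    exacts [h1 a ha, h2 a ha]

theorem models_iUnion {X : Type*} {ι : Type*} {S : ι → Set (Atom L X)} {f : X → M} :
    Models (⋃ i, S i) f ↔ ∀ i, Models (S i) f := by
  constructor
  · intro h i a ha
    exact h a (mem_iUnion_of_mem i ha)
  · intro h a ha
    obtain ⟨i, hi⟩ := mem_iUnion.1 ha
    exact h i a hi

theorem models_map {X Y : Type*} {S : Set (Atom L X)} {ρ : X → Y} {f : Y → M} :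
    Models (Atom.map ρ '' S) f ↔ Models S (f ∘ ρ) := by
  constructor
  · intro h a ha
    exact h _ (mem_image_of_mem _ ha)
  · rintro h _ ⟨a, ha, rfl⟩
    exact h a ha

theorem Occurs.mono {X : Type*} {S T : Set (Atom L X)} {x : X} (hST : S ⊆ T) (h : Occurs S x) :
    Occurs T x := by
  obtain ⟨a, ha, hx⟩ := h
  exact ⟨a, hST ha, hx⟩

theorem Occurs.map {X Y : Type*} {S : Set (Atom L X)} {x : X} (ρ : X → Y) (h : Occurs S x) :
    Occurs (Atom.map ρ '' S) (ρ x) := by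
  obtain ⟨a, ha, i, hi⟩ := h
  exact ⟨_, mem_image_of_mem _ ha, i, congrArg ρ hi⟩

open Classical in
theorem Models.update_of_not_occurs {X : Type*} {S : Set (Atom L X)} {x : X} {f : X → M}
    (h : Models S f) (hx : ¬ Occurs S x) (c : M) : Models S (update f x c) := by
  intro a ha
  have hf : update f x c ∘ a.args = f ∘ a.args := by
    funext i
    refine update_of_ne ?_ _ _
    rintro hi
    exact hx ⟨a, ha, i, hi⟩
  have := h a ha
  unfold Atom.Holds at this ⊢
  rwa [hf]

/-- Every non-empty finite set of atoms is equivalent to a formula built from atoms and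
conjunctions. -/
theorem exists_formula {S : Set (Atom L ℕ)} (hS : S.Finite) (hne : S.Nonempty) :
    ∃ φ : L.Formula ℕ, IsAFormula φ ∧ (∀ f : ℕ → M, φ.Realize f ↔ Models S f) ∧
      ∀ x, Occurs S x → x ∈ φ.freeVarFinset := by
  have single (a : Atom L ℕ) : ∃ φ : L.Formula ℕ, IsAFormula φ ∧
      (∀ f : ℕ → M, φ.Realize f ↔ a.Holds f) ∧ ∀ x ∈ range a.args, x ∈ φ.freeVarFinset := by
    refine ⟨FirstOrder.Language.BoundedFormula.rel a.rel
      (fun i => FirstOrder.Language.Term.var (Sum.inl (a.args i))), .rel _ _, ?_, ?_⟩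
    · intro f
      exact FirstOrder.Language.BoundedFormula.realize_rel
    · rintro _ ⟨i, rfl⟩
      simp only [FirstOrder.Language.BoundedFormula.freeVarFinset, Finset.mem_biUnion,
        Finset.mem_univ, true_and]
      exact ⟨i, by simp [FirstOrder.Language.Term.varFinsetLeft]⟩
  -- The empty conjunction is not an `IsAFormula`, so the induction keeps one extra atom `a` at
  -- hand.
  have key : ∀ a : Atom L ℕ, ∃ φ : L.Formula ℕ, IsAFormula φ ∧
      (∀ f : ℕ → M, φ.Realize f ↔ Models (insert a S) f) ∧
      ∀ x, Occurs (insert a S) x → x ∈ φ.freeVarFinset := by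
    clear hne
    induction S, hS using Set.Finite.induction_on with
    | empty =>
      intro a
      obtain ⟨φ, h1, h2, h3⟩ := single a
      refine ⟨φ, h1, fun f => (h2 f).trans ?_, ?_⟩
      · simp [Models]
      · rintro x ⟨b, hb, hx⟩
        obtain rfl : b = a := by simpa using hb
        exact h3 x hx
    | @insert b S _ _ ih =>
      intro a
      obtain ⟨φ, h1, h2, h3⟩ := single a
      obtain ⟨ψ, k1, k2, k3⟩ := ih b
      refine ⟨φ ⊓ ψ, h1.inf k1, fun f => ?_, ?_⟩
      · rw [FirstOrder.Language.Formula.realize_inf, h2, k2]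
        simp [Models]
      · rintro x ⟨c, hc, hx⟩
        have hfv : FirstOrder.Language.BoundedFormula.freeVarFinset (φ ⊓ ψ) =
            φ.freeVarFinset ∪ ψ.freeVarFinset := by
          change (φ.freeVarFinset ∪ (ψ.freeVarFinset ∪ ∅)) ∪ ∅ = _
          simp
        rw [hfv]
        rcases hc with rfl | hc
        · exact Finset.mem_union_left _ (h3 x hx)
        · exact Finset.mem_union_right _ (k3 x ⟨c, hc, hx⟩)
  obtain ⟨a, ha⟩ := hne
  have := key a
  rwa [insert_eq_of_mem ha] at this

variable (L) in
/-- `R` is the projection, to pairwise different variables, of the set of models of a finite set of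
atoms. Unlike in `IsADefinable`, the variables need not occur in the atoms. -/
def IsCQDefinable {α : Type} (R : Set (α → M)) : Prop :=
  ∃ (X : Type) (_ : Countable X) (S : Set (Atom L X)) (p : α → X), S.Finite ∧ Injective p ∧
    R = {a | ∃ f : X → M, Models S f ∧ f ∘ p = a}

open Classical in
/-- Closure of definable relations under conjunctions, identifications of variables and
projections. -/
theorem IsCQDefinable.glue {κ : Type} [Finite κ] {α β : Type} [Countable β] {γ : κ → Type}
    {R : ∀ c, Set (γ c → M)} (hR : ∀ c, IsCQDefinable L (R c)) (s : ∀ c, γ c → β) {p : α → β}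
    (hp : Injective p) :
    IsCQDefinable L {a : α → M | ∃ g : β → M, (∀ c, g ∘ s c ∈ R c) ∧ g ∘ p = a} := by
  choose X hX S q hS hq hRS using hR
  -- Distinguished variables are sent to their prescribed targets, possibly identifying them; every
  -- quantified variable gets a private copy for its conjunct.
  let ρ : ∀ c, X c → β ⊕ (Σ c, X c) := fun c x =>
    if h : ∃ a, q c a = x then Sum.inl (s c h.choose) else Sum.inr ⟨c, x⟩
  have hρ : ∀ c a, ρ c (q c a) = Sum.inl (s c a) := by
    intro c a
    have h : ∃ a', q c a' = q c a := ⟨a, rfl⟩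
    simp only [ρ, dif_pos h]
    rw [hq c h.choose_spec]
  refine ⟨β ⊕ (Σ c, X c), inferInstance, ⋃ c, Atom.map (ρ c) '' S c, Sum.inl ∘ p,
    Set.finite_iUnion fun c => (hS c).image _, Sum.inl_injective.comp hp, ?_⟩
  ext a
  constructor
  · rintro ⟨g, hg, rfl⟩
    have : ∀ c, ∃ f : X c → M, Models (S c) f ∧ f ∘ q c = g ∘ s c := fun c => by
      have := hg c
      rwa [hRS c] at this
    choose f hf hfq using this
    refine ⟨Sum.elim g (fun x => f x.1 x.2), ?_, rfl⟩
    rw [models_iUnion]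
    intro c
    rw [models_map]
    convert hf c
    funext x
    by_cases h : ∃ a, q c a = x
    · obtain ⟨a, rfl⟩ := h
      simpa [hρ] using (congrFun (hfq c) a).symm
    · simp [ρ, h]
  · rintro ⟨F, hF, rfl⟩
    refine ⟨F ∘ Sum.inl, fun c => ?_, rfl⟩
    rw [models_iUnion] at hF
    rw [hRS c]
    refine ⟨F ∘ ρ c, models_map.1 (hF c), ?_⟩
    funext a
    simp [hρ]

end ConjunctiveQueries

/-! ### Steps between pairs of relations, and the absence of cycles -/

section Steps

variable {L : FirstOrder.Language.{u, v}} {M : Type w} [L.Structure M] {n : ℕ}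

/-- The atoms `S` define an implication from `C ⊆ W`, on the variables `p`, to `C' ⊆ W'`, on the
variables `q`. The two tuples of variables are different, and agree at common variables. -/
structure IsStep {X : Type} (S : Set (Atom L X)) (p q : Fin n → X)
    (W C W' C' : Set (Fin n → M)) : Prop where
  finite : S.Finite
  injective_left : Injective p
  injective_right : Injective q
  aligned : ∀ i j, p i = q j → i = j
  exists_ne : ∃ i, p i ≠ q i
  left : W = {a | ∃ f : X → M, Models S f ∧ f ∘ p = a}
  right : W' = {a | ∃ f : X → M, Models S f ∧ f ∘ q = a}
  imp : ∀ f : X → M, Models S f → f ∘ p ∈ C → f ∘ q ∈ C'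
  onto : ∀ a ∈ C', ∃ f : X → M, Models S f ∧ f ∘ p ∈ C ∧ f ∘ q = a

variable (L) in
/-- The pair `C ⊆ W` implies the pair `C' ⊆ W'`. -/
def Step (P P' : Set (Fin n → M) × Set (Fin n → M)) : Prop :=
  ∃ (X : Type) (_ : Countable X) (S : Set (Atom L X)) (p q : Fin n → X),
    IsStep S p q P.1 P.2 P'.1 P'.2

-- The target variables of the first step are glued to the source variables of the second. Both have
-- projection `P'.1` there, so solutions of either part extend to the other and the outer
-- projections do not shrink. Alignment ensures that a position moved by the first step cannot
-- return to its old variable.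
open Classical in
theorem Step.trans {P P' P'' : Set (Fin n → M) × Set (Fin n → M)} (h : Step L P P')
    (h' : Step L P' P'') : Step L P P'' := by
  obtain ⟨X, _, S, p, q, hS⟩ := h
  obtain ⟨Y, _, T, p', q', hT⟩ := h'
  let ρ : Y → X ⊕ Y := fun y => if h : ∃ i, p' i = y then Sum.inl (q h.choose) else Sum.inr y
  have hρ : ∀ i, ρ (p' i) = Sum.inl (q i) := by
    intro i
    have h : ∃ j, p' j = p' i := ⟨i, rfl⟩
    simp only [ρ, dif_pos h]
    rw [hT.injective_left h.choose_spec]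
  have hρ' : ∀ y x, ρ y = Sum.inl x → ∃ i, p' i = y ∧ x = q i := by
    intro y x hyx
    by_cases h : ∃ i, p' i = y
    · obtain ⟨i, rfl⟩ := h
      rw [hρ] at hyx
      exact ⟨i, rfl, (Sum.inl_injective hyx).symm⟩
    · simp [ρ, h] at hyx
  have hinj : Injective ρ := by
    intro y z hyz
    by_cases h : ∃ i, p' i = y
    · obtain ⟨i, rfl⟩ := h
      rw [hρ] at hyz
      obtain ⟨j, rfl, hj⟩ := hρ' z _ hyz.symm
      rw [hS.injective_right hj]
    · have hy : ρ y = Sum.inr y := by simp [ρ, h]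
      rw [hy] at hyz
      by_cases h' : ∃ i, p' i = z
      · obtain ⟨i, rfl⟩ := h'
        simp [hρ] at hyz
      · simpa [ρ, h'] using hyz
  have hmod : ∀ F : X ⊕ Y → M, Models (Atom.map Sum.inl '' S ∪ Atom.map ρ '' T) F ↔
      Models S (F ∘ Sum.inl) ∧ Models T (F ∘ ρ) := by
    intro F
    rw [models_union, models_map, models_map]
  have hFp : ∀ F : X ⊕ Y → M, (F ∘ Sum.inl) ∘ q = (F ∘ ρ) ∘ p' := by
    intro F
    funext i
    simp [hρ]
  have hex : ∀ (f : X → M) (g : Y → M), f ∘ q = g ∘ p' →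
      ∃ F : X ⊕ Y → M, F ∘ Sum.inl = f ∧ F ∘ ρ = g := by
    intro f g hfg
    refine ⟨Sum.elim f g, rfl, ?_⟩
    funext y
    by_cases h : ∃ i, p' i = y
    · obtain ⟨i, rfl⟩ := h
      simpa [hρ] using congrFun hfg i
    · simp [ρ, h]
  refine ⟨X ⊕ Y, inferInstance, Atom.map Sum.inl '' S ∪ Atom.map ρ '' T, Sum.inl ∘ p, ρ ∘ q',
    ?_, ?_, ?_, ?_, ?_, ?_, ?_, ?_, ?_⟩
  · exact (hS.finite.image _).union (hT.finite.image _)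
  · exact Sum.inl_injective.comp hS.injective_left
  · exact hinj.comp hT.injective_right
  · intro i j hij
    obtain ⟨k, hk, hk'⟩ := hρ' _ _ hij.symm
    obtain rfl := hT.aligned _ _ hk
    exact hS.aligned _ _ hk'
  · obtain ⟨i, hi⟩ := hS.exists_ne
    refine ⟨i, fun hi' => ?_⟩
    obtain ⟨k, hk, hk'⟩ := hρ' _ _ hi'.symm
    obtain rfl := hT.aligned _ _ hk
    exact hi hk'
  · rw [hS.left]
    ext a
    constructor
    · rintro ⟨f, hf, rfl⟩
      have : f ∘ q ∈ P'.1 := by rw [hS.right]; exact ⟨f, hf, rfl⟩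
      rw [hT.left] at this
      obtain ⟨g, hg, hgf⟩ := this
      obtain ⟨F, rfl, rfl⟩ := hex f g hgf.symm
      exact ⟨F, (hmod F).2 ⟨hf, hg⟩, rfl⟩
    · rintro ⟨F, hF, rfl⟩
      exact ⟨_, ((hmod F).1 hF).1, rfl⟩
  · rw [hT.right]
    ext a
    constructor
    · rintro ⟨g, hg, rfl⟩
      have : g ∘ p' ∈ P'.1 := by rw [hT.left]; exact ⟨g, hg, rfl⟩
      rw [hS.right] at this
      obtain ⟨f, hf, hgf⟩ := this
      obtain ⟨F, rfl, rfl⟩ := hex f g hgf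
      exact ⟨F, (hmod F).2 ⟨hf, hg⟩, rfl⟩
    · rintro ⟨F, hF, rfl⟩
      exact ⟨_, ((hmod F).1 hF).2, rfl⟩
  · intro F hF hFC
    obtain ⟨h1, h2⟩ := (hmod F).1 hF
    refine hT.imp _ h2 ?_
    rw [← hFp]
    exact hS.imp _ h1 hFC
  · intro a ha
    obtain ⟨g, hg, hgC, rfl⟩ := hT.onto a ha
    obtain ⟨f, hf, hfC, hfg⟩ := hS.onto _ hgC
    obtain ⟨F, rfl, rfl⟩ := hex f g hfg
    exact ⟨F, (hmod F).2 ⟨hf, hg⟩, hfC, rfl⟩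

variable (L) in
/-- `C` is a non-empty definable proper subset of `W` that has the same projections to all proper
sets of coordinates as `W`. -/
structure IsGoodPair (P : Set (Fin n → M) × Set (Fin n → M)) : Prop where
  definable : IsCQDefinable L P.2
  nonempty : P.2.Nonempty
  ssubset : P.2 ⊂ P.1
  exists_eqOn : ∀ a ∈ P.1, ∀ Z : Set (Fin n), Z ≠ univ → ∃ c ∈ P.2, EqOn c a Z

-- A step from `P` to itself is a balanced implication, and alignment together with a moved position
-- makes it stable. It is proper because the common variables occupy a proper subset of the
-- positions, where `C` and `W` have equal projections. The remaining work is to make all variables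
-- of the two tuples occur in the formula.
open Classical in
theorem IsUnbalanced.not_step [Nonempty M] (h : IsUnbalanced L M)
    {P : Set (Fin n → M) × Set (Fin n → M)} (hP : IsGoodPair L P) : ¬ Step L P P := by
  rintro ⟨X, _, S, p, q, hS⟩
  obtain ⟨W, C⟩ := P
  obtain ⟨X', _, T, r, hT, hr, hCT⟩ := hP.definable
  dsimp only at hS hCT
  obtain ⟨i₀, hi₀⟩ := hS.exists_ne
  obtain ⟨b, hbW, hbC⟩ := exists_of_ssubset hP.ssubset
  dsimp only at hbW hbC
  -- Off coordinate `i`, the tuple `b` agrees with an element of `C`, so changing one coordinate can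
  -- lead out of `C`. A variable without an occurrence would allow such a change.
  have hmissing (i : Fin n) : ∃ c ∈ C, update c i (b i) = b := by
    obtain ⟨c, hc, hcb⟩ := hP.exists_eqOn b hbW {i}ᶜ (fun h => (h ▸ mem_univ i : i ∈ ({i}ᶜ : Set _)) rfl)
    refine ⟨c, hc, ?_⟩
    funext j
    by_cases hj : j = i
    · subst hj; simp
    · rw [update_of_ne hj]; exact hcb hj
  have hcompu {Y : Type} {p : Fin n → Y} (hp : Injective p) (f : Y → M) (i : Fin n) (c : M) :
      update f (p i) c ∘ p = update (f ∘ p) i c := update_comp_eq_of_injective f hp i c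
  have hoccT (i : Fin n) : Occurs T (r i) := by
    by_contra hi
    obtain ⟨c, hc, hcb⟩ := hmissing i
    refine hbC ?_
    rw [hCT] at hc ⊢
    obtain ⟨f, hf, rfl⟩ := hc
    exact ⟨_, hf.update_of_not_occurs hi (b i), by rw [hcompu hr, hcb]⟩
  -- If `p i` were free to vary, a solution with value `b` on `q` could be moved into `C` on `p`
  -- without affecting `q`, which would force `b` into `C`.
  have hoccp (i : Fin n) (hi : p i ≠ q i) : Occurs S (p i) := by
    by_contra hocc
    have hbW' := hbW
    rw [hS.right] at hbW'
    obtain ⟨f, hf, hfb⟩ := hbW'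
    have hfp : f ∘ p ∈ W := by rw [hS.left]; exact ⟨f, hf, rfl⟩
    obtain ⟨c, hc, hcf⟩ := hP.exists_eqOn _ hfp {i}ᶜ
      (fun h => (h ▸ mem_univ i : i ∈ ({i}ᶜ : Set _)) rfl)
    have hm := hf.update_of_not_occurs hocc (c i)
    have h1 : update f (p i) (c i) ∘ p = c := by
      rw [hcompu hS.injective_left]
      funext j
      by_cases hj : j = i
      · subst hj; simp
      · rw [update_of_ne hj]; exact (hcf hj).symm
    have h2 : update f (p i) (c i) ∘ q = b := by
      rw [← hfb]
      funext j
      refine update_of_ne (fun hj => ?_) _ _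
      obtain rfl := hS.aligned _ _ hj.symm
      exact hi hj.symm
    rw [← h2] at hbC
    exact hbC (hS.imp _ hm (by rw [h1]; exact hc))
  -- Here the value on `p` stays in `C` while the value on `q` is moved to `b`.
  have hoccq (i : Fin n) (hi : p i ≠ q i) : Occurs S (q i) := by
    by_contra hocc
    obtain ⟨c, hc, hcb⟩ := hmissing i
    obtain ⟨f, hf, hfp, rfl⟩ := hS.onto c hc
    have hm := hf.update_of_not_occurs hocc (b i)
    refine hbC ?_
    rw [← hcb, ← hcompu hS.injective_right]
    refine hS.imp _ hm ?_
    convert hfp using 1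
    funext j
    refine update_of_ne (fun hj => ?_) _ _
    obtain rfl := hS.aligned _ _ hj
    exact hi hj
  -- fresh copies of the definition of `C` make the common variables occur
  let ρ : Fin n → X' → X ⊕ (Fin n × X') := fun i x =>
    if x = r i then Sum.inl (p i) else Sum.inr (i, x)
  let κ := {i : Fin n // p i = q i}
  let U : Set (Atom L (X ⊕ (Fin n × X'))) :=
    Atom.map Sum.inl '' S ∪ ⋃ i : κ, Atom.map (ρ i.1) '' T
  have hUfin : U.Finite := (hS.finite.image _).union (Set.finite_iUnion fun i => hT.image _)
  have hUS : ∀ F : X ⊕ (Fin n × X') → M, Models U F → Models S (F ∘ Sum.inl) := by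
    intro F hF
    exact models_map.1 (models_union.1 hF).1
  have hκ : {i : Fin n | p i = q i} ≠ univ := fun h =>
    hi₀ (h ▸ mem_univ i₀ : i₀ ∈ {i : Fin n | p i = q i})
  -- The added copies exclude no solution: a single element of `C` that agrees with `f ∘ p` at all
  -- common positions witnesses all of them.
  have hSU : ∀ f : X → M, Models S f → ∃ F : X ⊕ (Fin n × X') → M, Models U F ∧
      F ∘ Sum.inl = f := by
    intro f hf
    have hfW : f ∘ p ∈ W := by rw [hS.left]; exact ⟨f, hf, rfl⟩
    obtain ⟨c, hc, hcf⟩ := hP.exists_eqOn _ hfW _ hκ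
    dsimp only at hc
    rw [hCT] at hc
    obtain ⟨g, hg, rfl⟩ := hc
    refine ⟨Sum.elim f (fun x => g x.2), models_union.2 ⟨models_map.2 hf, ?_⟩, rfl⟩
    rw [models_iUnion]
    intro i
    rw [models_map]
    convert hg
    funext x
    by_cases hx : x = r i.1
    · subst hx
      simpa [ρ] using (hcf i.2).symm
    · simp [ρ, hx]
  have hoccU (x : Fin n) : Occurs U (Sum.inl (p x)) ∧ Occurs U (Sum.inl (q x)) := by
    by_cases hx : p x = q x
    · rw [← hx, and_self]
      have h1 := (hoccT x).map (ρ x)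
      have h2 : ρ x (r x) = Sum.inl (p x) := by simp [ρ]
      rw [h2] at h1
      exact h1.mono ((subset_iUnion (fun i : κ => Atom.map (ρ i.1) '' T) ⟨x, hx⟩).trans
        subset_union_right)
    · exact ⟨((hoccp x hx).map _).mono subset_union_left,
        ((hoccq x hx).map _).mono subset_union_left⟩
  obtain ⟨e, he⟩ := exists_injective_nat (X ⊕ (Fin n × X'))
  obtain ⟨e', he'⟩ := exists_injective_nat X'
  obtain ⟨φ, hφ1, hφ2, hφ3⟩ := exists_formula (M := M) (hUfin.image (Atom.map e)) (by
    obtain ⟨a, ha, -⟩ := (hoccU i₀).1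
    exact ⟨_, mem_image_of_mem _ ha⟩)
  obtain ⟨ψ, hψ1, hψ2, hψ3⟩ := exists_formula (M := M) (hT.image (Atom.map e')) (by
    obtain ⟨a, ha, -⟩ := hoccT i₀
    exact ⟨_, mem_image_of_mem _ ha⟩)
  have hψC : C = proj (e' ∘ r) (sols M ψ) := by
    rw [hCT]
    ext a
    constructor
    · rintro ⟨f, hf, rfl⟩
      obtain ⟨F, rfl⟩ := he'.surjective_comp_right f
      exact ⟨F, (hψ2 F).2 (models_map.2 hf), rfl⟩
    · rintro ⟨F, hF, rfl⟩
      exact ⟨F ∘ e', models_map.1 ((hψ2 F).1 hF), rfl⟩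
  have hCdef : IsADefinable L C :=
    ⟨ψ, e' ∘ r, hψ1, he'.comp hr, fun i => hψ3 _ ((hoccT i).map _), hψC⟩
  let p' : Fin n → ℕ := e ∘ Sum.inl ∘ p
  let q' : Fin n → ℕ := e ∘ Sum.inl ∘ q
  have hp' : Injective p' := he.comp (Sum.inl_injective.comp hS.injective_left)
  have hq' : Injective q' := he.comp (Sum.inl_injective.comp hS.injective_right)
  have hpq (i j : Fin n) (hij : p' i = q' j) : p i = q j := Sum.inl_injective (he hij)
  have hsol : ∀ F : ℕ → M, F ∈ sols M φ → Models S (F ∘ e ∘ Sum.inl) := fun F hF =>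
    hUS _ (models_map.1 ((hφ2 F).1 hF))
  have hsol' : ∀ f : X → M, Models S f → ∃ F ∈ sols M φ, F ∘ e ∘ Sum.inl = f := by
    intro f hf
    obtain ⟨g, hg, rfl⟩ := hSU f hf
    obtain ⟨F, rfl⟩ := he.surjective_comp_right g
    exact ⟨F, (hφ2 F).2 (models_map.2 hg), rfl⟩
  have hWp : W = proj p' (sols M φ) := by
    rw [hS.left]
    ext a
    constructor
    · rintro ⟨f, hf, rfl⟩
      obtain ⟨F, hF, rfl⟩ := hsol' f hf
      exact ⟨F, hF, rfl⟩
    · rintro ⟨F, hF, rfl⟩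
      exact ⟨_, hsol F hF, rfl⟩
  have hWq : W = proj q' (sols M φ) := by
    rw [hS.right]
    ext a
    constructor
    · rintro ⟨f, hf, rfl⟩
      obtain ⟨F, hF, rfl⟩ := hsol' f hf
      exact ⟨F, hF, rfl⟩
    · rintro ⟨F, hF, rfl⟩
      exact ⟨_, hsol F hF, rfl⟩
  have hcommon : ∀ x ∈ range p' ∩ range q', ∃ i, p i = q i ∧ p' i = x ∧ q' i = x := by
    rintro _ ⟨⟨i, rfl⟩, ⟨j, hj⟩⟩
    have hij := hpq i j hj.symm
    obtain rfl := hS.aligned _ _ hij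
    exact ⟨i, hij, rfl, hj⟩
  have hagree {F G : ℕ → M} (hFG : ∀ i, p i = q i → F (p' i) = G (p' i)) :
      (range p' ∩ range q').domRestrict F = (range p' ∩ range q').domRestrict G := by
    funext x
    obtain ⟨i, hi, hx, -⟩ := hcommon x.1 x.2
    rw [domRestrict_apply, domRestrict_apply, ← hx]
    exact hFG i hi
  have hp'q' : ∀ i, p i = q i → p' i = q' i := by
    intro i hi
    simp [p', q', hi]
  refine h ⟨n, φ, C, C, p', q', ⟨hφ1, hCdef, hCdef, hP.nonempty, hP.nonempty, hp', hq',
    fun i => hφ3 _ ((hoccU i).1.map e), fun i => hφ3 _ ((hoccU i).2.map e), hWp ▸ hP.ssubset,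
    hWq ▸ hP.ssubset, fun F hF hFC => hS.imp _ (hsol F hF) hFC, ?_⟩, ⟨⟨?_, ?_⟩, ?_⟩,
    ⟨rfl, hWp ▸ hWq⟩, ?_, ?_⟩
  · intro a ha
    obtain ⟨f, hf, hfC, rfl⟩ := hS.onto a ha
    obtain ⟨F, hF, rfl⟩ := hsol' f hf
    exact ⟨F, hF, hfC, rfl⟩
  · intro hall
    obtain ⟨j, hj⟩ := hall i₀
    have := hpq _ _ hj
    obtain rfl := hS.aligned _ _ this
    exact hi₀ this
  · intro hall
    obtain ⟨j, hj⟩ := hall i₀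
    have := hpq _ _ hj
    obtain rfl := hS.aligned _ _ this
    exact hi₀ this
  · intro i j hij
    rw [hS.aligned _ _ (hpq _ _ hij)]
  · apply Subset.antisymm
    · rintro _ ⟨F, hF, rfl⟩
      have hFW : F ∘ p' ∈ W := by rw [hWp]; exact ⟨F, hF, rfl⟩
      obtain ⟨c, hc, hcF⟩ := hP.exists_eqOn _ hFW _ hκ
      obtain ⟨G, hG⟩ := hp'.surjective_comp_right c
      exact ⟨G, by simpa [hG] using hc, hagree fun i hi => (congrFun hG i).trans (hcF hi)⟩
    · rintro _ ⟨G, hG, rfl⟩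
      have : G ∘ p' ∈ W := hP.ssubset.subset hG
      rw [hWp] at this
      obtain ⟨F, hF, hFG⟩ := this
      exact ⟨F, hF, hagree fun i _ => congrFun hFG i⟩
  · apply Subset.antisymm
    · rintro _ ⟨G, hG, rfl⟩
      obtain ⟨F, hF⟩ := hq'.surjective_comp_right (G ∘ p')
      refine ⟨F, ?_, hagree fun i hi => ?_⟩
      · dsimp only at hF
        rw [mem_ofPred_eq, hF]
        exact hG
      · rw [hp'q' i hi]
        exact (congrFun hF i).trans (by simp [hp'q' i hi])
    · rintro _ ⟨G, hG, rfl⟩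
      obtain ⟨F, hF⟩ := hp'.surjective_comp_right (G ∘ q')
      refine ⟨F, ?_, hagree fun i hi => ?_⟩
      · dsimp only at hF
        rw [mem_ofPred_eq, hF]
        exact hG
      · exact (congrFun hF i).trans (by simp [hp'q' i hi])

end Steps

end FiniteDuality

namespace FiniteDuality

open Function Set

universe u v w

/-! ### Bounded length of chains of steps -/

section Reach

variable {L : FirstOrder.Language.{u, v}} {M : Type w} [L.Structure M] {n : ℕ}

variable (L M n) in
/-- The pairs of definable relations of arity `n`. -/
def definablePairs : Set (Set (Fin n → M) × Set (Fin n → M)) :=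
  {R | IsCQDefinable L R} ×ˢ {R | IsCQDefinable L R}

variable (L) in
/-- There are `d` pairs of definable relations, different from `P` and from each other, that
imply `P`. -/
def Reach (d : ℕ) (P : Set (Fin n → M) × Set (Fin n → M)) : Prop :=
  ∃ F ⊆ definablePairs L M n, F.Finite ∧ F.ncard = d + 1 ∧ ∀ Q ∈ F, Q = P ∨ Step L Q P

theorem reach_zero {P : Set (Fin n → M) × Set (Fin n → M)} (hP : P ∈ definablePairs L M n) :
    Reach L 0 P :=
  ⟨{P}, by simpa using hP, finite_singleton P, by simp, by simp⟩

/-- By transitivity every pair collected so far implies `P'`. If `P'` were among them, it would have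
a step to itself, which is impossible for a good pair; so the collection grows by one. -/
theorem Reach.step [Nonempty M] (hunb : IsUnbalanced L M) {d : ℕ}
    {P P' : Set (Fin n → M) × Set (Fin n → M)} (h : Reach L d P) (hs : Step L P P')
    (hP' : P' ∈ definablePairs L M n) (hgood : IsGoodPair L P') : Reach L (d + 1) P' := by
  obtain ⟨F, hF, hfin, hcard, hFP⟩ := h
  have hstep : ∀ Q ∈ F, Step L Q P' := by
    intro Q hQ
    rcases hFP Q hQ with rfl | h
    · exact hs
    · exact h.trans hs
  have hnot : P' ∉ F := fun h => hunb.not_step hgood (hstep _ h)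
  refine ⟨insert P' F, insert_subset hP' hF, hfin.insert _, ?_, ?_⟩
  · rw [ncard_insert_of_notMem hnot hfin, hcard]
  · rintro Q (rfl | hQ)
    · exact Or.inl rfl
    · exact Or.inr (hstep Q hQ)

theorem Reach.lt (hfin : {R : Set (Fin n → M) | IsCQDefinable L R}.Finite) {d : ℕ}
    {P : Set (Fin n → M) × Set (Fin n → M)} (h : Reach L d P) :
    d < (definablePairs L M n).ncard := by
  obtain ⟨F, hF, -, hcard, -⟩ := h
  have := ncard_le_ncard hF (hfin.prod hfin)
  omega

end Reach

/-! ### Definable constraints on finite sets of variables, as sets of total assignments -/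

section Cylinders

variable {L : FirstOrder.Language.{u, v}} {M : Type w} [L.Structure M] {V : Type}

/-- The cylinder generated by the restrictions of the elements of `H` to `X`. -/
def cyl (X : Finset V) (H : Set (V → M)) : Set (V → M) := {g | ∃ h ∈ H, EqOn g h X}

/-- Membership in `H` depends only on the values on `X`. -/
def IsCyl (X : Finset V) (H : Set (V → M)) : Prop := ∀ ⦃g h⦄, EqOn g h X → h ∈ H → g ∈ H

variable (L) in
/-- `H` is a cylinder over a definable relation on `X`. -/
def DefOn (X : Finset V) (H : Set (V → M)) : Prop :=
  ∃ Q : Set (X → M), IsCQDefinable L Q ∧ H = {g | (fun x : X => g x) ∈ Q}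

variable (L) in
/-- `R` is a minimal non-empty cylinder over a definable relation on `X`. -/
structure MinDef (X : Finset V) (R : Set (V → M)) : Prop where
  defOn : DefOn L X R
  nonempty : R.Nonempty
  eq_of_subset : ∀ H ⊆ R, DefOn L X H → H.Nonempty → H = R

theorem subset_cyl (X : Finset V) (H : Set (V → M)) : H ⊆ cyl X H :=
  fun g hg => ⟨g, hg, eqOn_refl _ _⟩

theorem isCyl_cyl (X : Finset V) (H : Set (V → M)) : IsCyl X (cyl X H) := by
  rintro g h hgh ⟨k, hk, hhk⟩
  exact ⟨k, hk, hgh.trans hhk⟩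

theorem cyl_mono {X : Finset V} {H H' : Set (V → M)} (h : H ⊆ H') : cyl X H ⊆ cyl X H' := by
  rintro g ⟨k, hk, hgk⟩
  exact ⟨k, h hk, hgk⟩

theorem IsCyl.cyl_subset {X : Finset V} {H H' : Set (V → M)} (h : IsCyl X H') (hH : H ⊆ H') :
    cyl X H ⊆ H' := by
  rintro g ⟨k, hk, hgk⟩
  exact h hgk (hH hk)

theorem IsCyl.cyl_eq {X : Finset V} {H : Set (V → M)} (h : IsCyl X H) : cyl X H = H :=
  (h.cyl_subset subset_rfl).antisymm (subset_cyl X H)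

theorem IsCyl.mono {X Y : Finset V} {H : Set (V → M)} (h : IsCyl X H) (hXY : X ⊆ Y) :
    IsCyl Y H := fun _ _ hgk hk => h (hgk.mono (by exact_mod_cast hXY)) hk

theorem IsCyl.inter {X : Finset V} {H H' : Set (V → M)} (h : IsCyl X H) (h' : IsCyl X H') :
    IsCyl X (H ∩ H') := fun _ _ hgk hk => ⟨h hgk hk.1, h' hgk hk.2⟩

theorem IsCyl.iInter {X : Finset V} {κ : Type*} {H : κ → Set (V → M)} (h : ∀ c, IsCyl X (H c)) :
    IsCyl X (⋂ c, H c) := fun _ _ hgk hk =>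
  mem_iInter.2 fun c => h c hgk (mem_iInter.1 hk c)

theorem cyl_inter_right {X : Finset V} {H B : Set (V → M)} (hB : IsCyl X B) :
    cyl X (H ∩ B) = cyl X H ∩ B := by
  ext g
  constructor
  · rintro ⟨h, ⟨hH, hhB⟩, hgh⟩
    exact ⟨⟨h, hH, hgh⟩, hB hgh hhB⟩
  · rintro ⟨⟨h, hH, hgh⟩, hgB⟩
    exact ⟨h, ⟨hH, hB hgh.symm hgB⟩, hgh⟩

theorem cyl_inter_nonempty {X : Finset V} {H B : Set (V → M)} (hB : IsCyl X B) :
    (cyl X H ∩ B).Nonempty ↔ (H ∩ B).Nonempty := by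
  rw [← cyl_inter_right hB]
  constructor
  · rintro ⟨_, h, hh, -⟩
    exact ⟨h, hh⟩
  · exact fun h => h.mono (subset_cyl _ _)

theorem DefOn.isCyl {X : Finset V} {H : Set (V → M)} (h : DefOn L X H) : IsCyl X H := by
  obtain ⟨Q, -, rfl⟩ := h
  intro g h hgh hh
  have : (fun x : X => g x) = fun x : X => h x := funext fun x => hgh x.2
  simpa [this] using hh

-- The counterpart of `IsCQDefinable.glue` for cylinders: conjunction followed by projection.
-- Closure under intersection, enlargement of the variable set and projection, and definability of
-- the trivial constraint, are all special cases.
open Classical in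
theorem DefOn.cyl_iInter [Nonempty M] {κ : Type} [Finite κ] {X : κ → Finset V}
    {H : κ → Set (V → M)} (h : ∀ c, DefOn L (X c) (H c)) {Y Z : Finset V} (hXZ : ∀ c, X c ⊆ Z)
    (hYZ : Y ⊆ Z) : DefOn L Y (cyl Y (⋂ c, H c)) := by
  choose Q hQ hHQ using h
  have hQ' := IsCQDefinable.glue hQ (β := Z) (fun c x => ⟨x.1, hXZ c x.2⟩)
    (p := fun y : Y => (⟨y.1, hYZ y.2⟩ : Z)) (fun x y hxy => Subtype.ext (congrArg Subtype.val hxy :))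
  refine ⟨_, hQ', ?_⟩
  ext g
  constructor
  · rintro ⟨k, hk, hgk⟩
    refine ⟨fun z => k z, fun c => ?_, ?_⟩
    · have := mem_iInter.1 hk c
      rw [hHQ c] at this
      exact this
    · funext y
      exact (hgk y.2).symm
  · rintro ⟨k, hk, hgk⟩
    refine ⟨fun x => if hx : x ∈ Z then k ⟨x, hx⟩ else g x, mem_iInter.2 fun c => ?_, ?_⟩
    · rw [hHQ c]
      change (fun x : X c => _) ∈ Q c
      convert hk c using 2
      simp [hXZ c (Subtype.property _)]
    · intro y hy
      have := congrFun hgk ⟨y, hy⟩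
      simp only [comp_apply] at this
      have hyZ := hYZ (Finset.mem_coe.1 hy)
      simp [hyZ, ← this]

theorem DefOn.iInter [Nonempty M] {κ : Type*} [Finite κ] {X : κ → Finset V}
    {H : κ → Set (V → M)} (h : ∀ c, DefOn L (X c) (H c)) {Z : Finset V} (hXZ : ∀ c, X c ⊆ Z) :
    DefOn L Z (⋂ c, H c) := by
  obtain ⟨m, ⟨e⟩⟩ := (finite_iff_exists_equiv_fin (α := κ)).1 inferInstance
  have := DefOn.cyl_iInter (fun i => h (e.symm i)) (fun i => hXZ (e.symm i)) (subset_refl Z)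
  rwa [e.symm.surjective.iInter_comp H,
    IsCyl.cyl_eq (IsCyl.iInter fun c => (h c).isCyl.mono (hXZ c))] at this

theorem DefOn.mono [Nonempty M] {X Y : Finset V} {H : Set (V → M)} (h : DefOn L X H)
    (hXY : X ⊆ Y) : DefOn L Y H := by
  have := DefOn.iInter (κ := Unit) (fun _ => h) (fun _ => hXY)
  rwa [iInter_const] at this

theorem DefOn.inter [Nonempty M] {X : Finset V} {H H' : Set (V → M)} (h : DefOn L X H)
    (h' : DefOn L X H') : DefOn L X (H ∩ H') := by
  have := DefOn.iInter (κ := Bool) (H := fun b => cond b H H') (X := fun _ => X) (Z := X) (L := L)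
    (by rintro (_ | _) <;> assumption) (fun _ => subset_refl _)
  rwa [← inter_eq_iInter] at this

theorem DefOn.cyl [Nonempty M] {X Y : Finset V} {H : Set (V → M)} (h : DefOn L X H)
    (hYX : Y ⊆ X) : DefOn L Y (cyl Y H) := by
  have := DefOn.cyl_iInter (κ := Unit) (fun _ => h) (fun _ => subset_refl X) hYX
  rwa [iInter_const] at this

theorem defOn_univ [Nonempty M] (X : Finset V) : DefOn L X (univ : Set (V → M)) := by
  have := DefOn.iInter (L := L) (M := M) (κ := Empty) (X := fun _ => X) (H := fun c => c.elim)
    (fun c => c.elim) (Z := X) (fun c => c.elim)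
  rwa [iInter_of_empty] at this

theorem defOn_atom [Nonempty M] {X : Finset V} {r : ℕ} (R : L.Relations r) (x : Fin r → V)
    (hx : ∀ i, x i ∈ X) :
    DefOn L X {g : V → M | FirstOrder.Language.Structure.RelMap R (g ∘ x)} := by
  have h1 : IsCQDefinable L {a : Fin r → M | FirstOrder.Language.Structure.RelMap R a} := by
    refine ⟨Fin r, inferInstance, {⟨r, R, id⟩}, id, finite_singleton _, injective_id, ?_⟩
    ext a
    simp [Models, Atom.Holds]
  have h2 := IsCQDefinable.glue (κ := Unit) (fun _ => h1) (β := X) (fun _ i => ⟨x i, hx i⟩)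
    (p := id) injective_id
  refine ⟨_, h2, ?_⟩
  ext g
  simp only [comp_id, mem_ofPred_eq, exists_eq_right, forall_const]
  rfl

/-- The relation formed by the restrictions of the elements of `H` to the tuple `y`. -/
def pull {n : ℕ} (y : Fin n → V) (H : Set (V → M)) : Set (Fin n → M) := (· ∘ y) '' H

/-- `y` enumerates `Y` without repetition. -/
def Enumerates {n : ℕ} (y : Fin n → V) (Y : Finset V) : Prop := Injective y ∧ range y = Y

theorem exists_enumerates {n : ℕ} {Y : Finset V} (hY : Y.card = n) :
    ∃ y : Fin n → V, Enumerates y Y := by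
  subst hY
  refine ⟨fun i => Y.equivFin.symm i, Subtype.val_injective.comp (Equiv.injective _), ?_⟩
  ext x
  constructor
  · rintro ⟨i, rfl⟩
    exact (Y.equivFin.symm i).2
  · intro hx
    exact ⟨Y.equivFin ⟨x, hx⟩, by simp⟩

theorem IsCyl.comp_mem_pull {n : ℕ} {y : Fin n → V} {Y : Finset V} (hy : Enumerates y Y)
    {H : Set (V → M)} (hH : IsCyl Y H) {g : V → M} : g ∘ y ∈ pull y H ↔ g ∈ H := by
  constructor
  · rintro ⟨h, hh, hgh⟩
    refine hH ?_ hh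
    intro x hx
    rw [← hy.2] at hx
    obtain ⟨i, rfl⟩ := hx
    exact (congrFun hgh i).symm
  · exact fun h => ⟨g, h, rfl⟩

theorem pull_injOn {n : ℕ} {y : Fin n → V} {Y : Finset V} (hy : Enumerates y Y) :
    InjOn (pull (M := M) y) {H | IsCyl Y H} := by
  intro H hH H' hH' h
  ext g
  rw [← IsCyl.comp_mem_pull hy hH, h, IsCyl.comp_mem_pull hy hH']

open Classical in
theorem DefOn.pull [Nonempty M] {n : ℕ} {y : Fin n → V} {Y : Finset V} (hy : Enumerates y Y)
    {H : Set (V → M)} (hH : DefOn L Y H) : IsCQDefinable L (pull y H) := by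
  have hmem : ∀ i, y i ∈ Y := fun i => by
    rw [← Finset.mem_coe, ← hy.2]
    exact mem_range_self i
  obtain ⟨Q, hQ, rfl⟩ := hH
  have := IsCQDefinable.glue (κ := Unit) (fun _ => hQ) (β := Y) (fun _ => id)
    (p := fun i => ⟨y i, hmem i⟩) (fun i j hij => hy.1 (by simpa using hij))
  convert this
  ext a
  constructor
  · rintro ⟨g, hg, rfl⟩
    exact ⟨fun x => g x, fun _ => hg, rfl⟩
  · rintro ⟨g, hg, rfl⟩
    refine ⟨fun x => if hx : x ∈ Y then g ⟨x, hx⟩ else Classical.arbitrary M, ?_, ?_⟩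
    · simpa using hg ()
    · funext i
      simp [hmem i]

/-- Finitely many definable relations of arity `n` give finitely many definable cylinders over a
set with `n` elements, with the same bound. -/
theorem finite_defOn [Nonempty M] {n : ℕ}
    (hfin : {R : Set (Fin n → M) | IsCQDefinable L R}.Finite) {Y : Finset V} (hY : Y.card = n) :
    {H : Set (V → M) | DefOn L Y H}.Finite ∧ {H : Set (V → M) | DefOn L Y H}.ncard ≤
      {R : Set (Fin n → M) | IsCQDefinable L R}.ncard := by
  obtain ⟨y, hy⟩ := exists_enumerates hY
  have hmaps : MapsTo (pull (M := M) y) {H | DefOn L Y H} {R | IsCQDefinable L R} :=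
    fun H hH => DefOn.pull hy hH
  have hinj : InjOn (pull (M := M) y) {H | DefOn L Y H} :=
    (pull_injOn hy).mono fun H hH => DefOn.isCyl hH
  exact ⟨Finite.of_injOn hmaps hinj hfin, ncard_le_ncard_of_injOn _ hmaps hinj hfin⟩

open Classical in
/-- A definable relation on a set of variables containing `Y ≠ Y'` gives a step. -/
theorem exists_step [Nonempty M] {n : ℕ} {y : Fin n → V} {Y Y' Z : Finset V}
    (hy : Enumerates y Y) (hY' : Y'.card = n) (hne : Y ≠ Y') (hYZ : Y ⊆ Z) (hYZ' : Y' ⊆ Z)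
    {E C : Set (V → M)} (hE : DefOn L Z E) (hC : IsCyl Y C) :
    ∃ y' : Fin n → V, Enumerates y' Y' ∧
      Step L (pull y (cyl Y E), pull y C) (pull y' (cyl Y' E), pull y' (cyl Y' (E ∩ C))) := by
  -- The enumeration of `Y'` gives each variable of `Y ∩ Y'` the position it has in `y`; this is the
  -- alignment required of a step.
  obtain ⟨e, he⟩ := Finset.exists_equiv_extend_of_card_eq (α := Fin n) (t := Y')
    (by simpa using hY'.symm) (s := Finset.univ.filter fun i => y i ∈ Y') (f := y)
    (by intro x hx; simp at hx; obtain ⟨i, hi, rfl⟩ := hx; exact hi) hy.1.injOn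
  have hy' : Enumerates (fun i => (e i : V)) Y' := by
    refine ⟨Subtype.val_injective.comp e.injective, ?_⟩
    ext x
    constructor
    · rintro ⟨i, rfl⟩
      exact (e i).2
    · intro hx
      exact ⟨e.symm ⟨x, hx⟩, by simp⟩
  refine ⟨fun i => (e i : V), hy', ?_⟩
  have hCd' : IsCyl Y' (cyl Y' (E ∩ C)) := isCyl_cyl _ _
  obtain ⟨Q, ⟨X, hX, S, q, hS, hq, hQ⟩, hEQ⟩ := hE
  have hyZ : ∀ i, y i ∈ Z := fun i => hYZ (by
    rw [← Finset.mem_coe, ← hy.2]; exact mem_range_self i)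
  have hyZ' : ∀ i, (e i : V) ∈ Z := fun i => hYZ' (e i).2
  have hto : ∀ f : X → M, Models S f → ∃ g ∈ E, ∀ z : Z, g z = f (q z) := by
    intro f hf
    refine ⟨fun x => if hx : x ∈ Z then f (q ⟨x, hx⟩) else Classical.arbitrary M, ?_, by simp⟩
    rw [hEQ, hQ]
    refine ⟨f, hf, ?_⟩
    funext z
    simp
  have hof : ∀ g ∈ E, ∃ f : X → M, Models S f ∧ ∀ z : Z, g z = f (q z) := by
    intro g hg
    rw [hEQ, hQ] at hg
    obtain ⟨f, hf, hfg⟩ := hg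
    exact ⟨f, hf, fun z => (congrFun hfg z).symm⟩
  refine ⟨X, hX, S, fun i => q ⟨y i, hyZ i⟩, fun i => q ⟨e i, hyZ' i⟩, hS, ?_, ?_, ?_, ?_, ?_, ?_,
    ?_, ?_⟩
  · intro i j hij
    exact hy.1 (by simpa using hq hij)
  · intro i j hij
    exact hy'.1 (by simpa using hq hij)
  · intro i j hij
    have hij : y i = e j := by simpa using hq hij
    have h1 : y i ∈ Y' := hij ▸ (e j).2
    have h2 := he i (by simpa using h1)
    exact hy'.1 (h2.trans hij)
  · by_contra! hall
    refine hne (Finset.coe_injective ?_)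
    rw [← hy.2, ← hy'.2]
    congr 1
    funext i
    simpa using hq (hall i)
  · dsimp only
    ext a
    constructor
    · rintro ⟨g, ⟨h, hh, hgh⟩, rfl⟩
      obtain ⟨f, hf, hfh⟩ := hof h hh
      refine ⟨f, hf, ?_⟩
      funext i
      have : y i ∈ Y := by rw [← Finset.mem_coe, ← hy.2]; exact mem_range_self i
      exact (hfh ⟨y i, hyZ i⟩).symm.trans (hgh this).symm
    · rintro ⟨f, hf, rfl⟩
      obtain ⟨g, hg, hgf⟩ := hto f hf
      exact ⟨g, subset_cyl _ _ hg, funext fun i => hgf ⟨y i, hyZ i⟩⟩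
  · dsimp only
    ext a
    constructor
    · rintro ⟨g, ⟨h, hh, hgh⟩, rfl⟩
      obtain ⟨f, hf, hfh⟩ := hof h hh
      refine ⟨f, hf, ?_⟩
      funext i
      exact (hfh ⟨e i, hyZ' i⟩).symm.trans (hgh (e i).2).symm
    · rintro ⟨f, hf, rfl⟩
      obtain ⟨g, hg, hgf⟩ := hto f hf
      exact ⟨g, subset_cyl _ _ hg, funext fun i => hgf ⟨e i, hyZ' i⟩⟩
  · intro f hf hfC
    obtain ⟨g, hg, hgf⟩ := hto f hf
    have h1 : (f ∘ fun i => q ⟨y i, hyZ i⟩) = g ∘ y := funext fun i => (hgf ⟨y i, hyZ i⟩).symm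
    have h2 : (f ∘ fun i => q ⟨e i, hyZ' i⟩) = g ∘ fun i => (e i : V) :=
      funext fun i => (hgf ⟨e i, hyZ' i⟩).symm
    rw [h1, IsCyl.comp_mem_pull hy hC] at hfC
    rw [h2]
    exact ⟨g, subset_cyl _ _ ⟨hg, hfC⟩, rfl⟩
  · rintro _ ⟨g, ⟨h, ⟨hh, hhC⟩, hgh⟩, rfl⟩
    obtain ⟨f, hf, hfh⟩ := hof h hh
    refine ⟨f, hf, ?_, ?_⟩
    · have h1 : (f ∘ fun i => q ⟨y i, hyZ i⟩) = h ∘ y := funext fun i => (hfh ⟨y i, hyZ i⟩).symm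
      rw [h1]
      exact ⟨h, hhC, rfl⟩
    · funext i
      exact (hfh ⟨e i, hyZ' i⟩).symm.trans (hgh (e i).2).symm

end Cylinders

end FiniteDuality

namespace FiniteDuality

open Function Set

universe u v w

/-! ### Trees of bags, and consistent families of constraints of arity `n` -/

section LocalSystems

variable {L : FirstOrder.Language.{u, v}} {M : Type w} [L.Structure M] {V : Type} {n K : ℕ}
  {H : Finset V → Set (V → M)}

variable (L) in
/-- Definable constraints `H Z` for all finite sets `Z` of variables, such that less than `n`
variables are constrained to a minimal definable relation. -/
structure IsLocalSystem (n : ℕ) (H : Finset V → Set (V → M)) : Prop where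
  defOn : ∀ Z, DefOn L Z (H Z)
  anti : ∀ Y Z, Y ⊆ Z → H Z ⊆ H Y
  low : ∀ X : Finset V, X.card < n → ∃ R, MinDef L X R ∧ H X ⊆ R

-- On fewer than `n` variables the system is confined to a minimal definable `R`. The projection of
-- `C` is a non-empty definable subset of `R`, hence equal to `R`, and so it contains the projection
-- of `W`.
open Classical in
theorem IsLocalSystem.isGoodPair [Nonempty M] (hH : IsLocalSystem L n H) {Y : Finset V}
    {y : Fin n → V} (hy : Enumerates y Y) {W C : Set (V → M)} (hW : DefOn L Y W)
    (hC : DefOn L Y C) (hne : C.Nonempty) (hCW : C ⊂ W) (hWH : W ⊆ H Y) :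
    IsGoodPair L (pull y W, pull y C) := by
  refine ⟨hC.pull hy, hne.image _, ?_, ?_⟩
  · refine (image_mono hCW.subset).ssubset_of_ne fun h => hCW.ne ?_
    exact pull_injOn hy hC.isCyl hW.isCyl h
  · rintro _ ⟨g, hg, rfl⟩ Z hZ
    let X : Finset V := (Finset.univ.filter (· ∈ Z)).image y
    have hXY : X ⊆ Y := by
      intro x hx
      obtain ⟨i, -, rfl⟩ := Finset.mem_image.1 hx
      rw [← Finset.mem_coe, ← hy.2]
      exact mem_range_self i
    have hcard : X.card < n := by
      obtain ⟨i, hi⟩ := (ne_univ_iff_exists_notMem Z).1 hZ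
      calc X.card ≤ (Finset.univ.filter (· ∈ Z)).card := Finset.card_image_le
        _ < (Finset.univ : Finset (Fin n)).card := by
          refine Finset.card_lt_card (Finset.ssubset_univ_iff.2 fun h => hi ?_)
          have := h ▸ Finset.mem_univ i
          simpa using this
        _ = n := by simp
    obtain ⟨R, hR, hHR⟩ := hH.low X hcard
    have hHYR : H Y ⊆ R := (hH.anti X Y hXY).trans hHR
    have hCR : cyl X C = R := hR.eq_of_subset _
      (hR.defOn.isCyl.cyl_subset (hCW.subset.trans (hWH.trans hHYR))) (hC.cyl hXY)
      (hne.mono (subset_cyl _ _))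
    have hgR : g ∈ cyl X C := hCR ▸ hHYR (hWH hg)
    obtain ⟨c, hc, hgc⟩ := hgR
    refine ⟨c ∘ y, ⟨c, hc, rfl⟩, fun i hi => ?_⟩
    refine (hgc (Finset.mem_coe.2 (Finset.mem_image_of_mem _ ?_))).symm
    simpa using hi

/-- Finite trees whose nodes carry a bag `Z` of variables and a set `Y` of variables shared with the
parent. -/
inductive BagTree (V : Type) : Type
  | node (Z Y : Finset V) (r : ℕ) (c : Fin r → BagTree V) : BagTree V

namespace BagTree

/-- The bag of the root. -/
def bag : BagTree V → Finset V
  | node Z _ _ _ => Z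

/-- The set of variables onto which the tree is evaluated. -/
def top : BagTree V → Finset V
  | node _ Y _ _ => Y

/-- The number of nodes. -/
def size : BagTree V → ℕ
  | node _ _ _ c => 1 + ∑ i, (c i).size

/-- The length of a longest branch. -/
def height : BagTree V → ℕ
  | node _ _ _ c => Finset.univ.sup fun i => (c i).height + 1

/-- The constraint on the top variables that is imposed by the bags of the tree. -/
def eval (H : Finset V → Set (V → M)) : BagTree V → Set (V → M)
  | node Z Y _ c => cyl Y (H Z ∩ ⋂ i, (c i).eval H)

/-- The bags have at most `K` elements, and contain the top variables of the node and of its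
children. The children have `n` top variables, different from those of the node. -/
def Valid (n K : ℕ) : BagTree V → Prop
  | node Z Y _ c => Z.card ≤ K ∧ Y ⊆ Z ∧
      ∀ i, (c i).top.card = n ∧ (c i).top ≠ Y ∧ (c i).top ⊆ Z ∧ (c i).Valid n K

theorem Valid.bag_card {t : BagTree V} (h : t.Valid n K) : t.bag.card ≤ K := by
  cases t; exact h.1

theorem isCyl_eval (t : BagTree V) : IsCyl t.top (t.eval H) := by
  cases t; exact isCyl_cyl _ _

theorem Valid.defOn_eval [Nonempty M] (hH : IsLocalSystem L n H) :
    ∀ {t : BagTree V}, t.Valid n K → DefOn L t.top (t.eval H) := by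
  intro t
  induction t with
  | node Z Y r c ih =>
    intro h
    have h1 : DefOn L Z (⋂ i, (c i).eval H) :=
      DefOn.iInter (fun i => ih i (h.2.2 i).2.2.2) fun i => (h.2.2 i).2.2.1
    exact ((hH.defOn Z).inter h1).cyl h.2.1

theorem Valid.eval_subset (hH : IsLocalSystem L n H) {t : BagTree V} (h : t.Valid n K) :
    t.eval H ⊆ H t.top := by
  cases t with
  | node Z Y r c =>
    exact (hH.defOn Y).isCyl.cyl_subset (inter_subset_left.trans (hH.anti _ _ h.2.1))

/-- Replacing a child of a node by another tree. -/
theorem exists_side [Nonempty M] (hH : IsLocalSystem L n H) {Z Y : Finset V} {r : ℕ}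
    {c : Fin r → BagTree V} (h : (node Z Y r c).Valid n K) (i : Fin r) :
    ∃ G : Set (V → M), DefOn L Z G ∧ G ⊆ H Z ∧
      (node Z Y r c).eval H = cyl Y (G ∩ (c i).eval H) ∧
      ∀ t' : BagTree V, t'.Valid n K → t'.top = (c i).top → t'.size < (c i).size →
        ∃ t'' : BagTree V, t''.Valid n K ∧ t''.top = Y ∧ t''.size < (node Z Y r c).size ∧
          t''.eval H = cyl Y (G ∩ t'.eval H) := by
  classical
  have key : ∀ d : Fin r → BagTree V, (∀ j ≠ i, d j = c j) →
      H Z ∩ ⋂ j, (d j).eval H = (H Z ∩ ⋂ j : {j // j ≠ i}, (c j).eval H) ∩ (d i).eval H := by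
    intro d hd
    ext g
    simp only [mem_inter_iff, mem_iInter, Subtype.forall]
    constructor
    · rintro ⟨h1, h2⟩
      exact ⟨⟨h1, fun j hj => hd j hj ▸ h2 j⟩, h2 i⟩
    · rintro ⟨⟨h1, h2⟩, h3⟩
      refine ⟨h1, fun j => ?_⟩
      by_cases hj : j = i
      · exact hj ▸ h3
      · exact hd j hj ▸ h2 j hj
  -- `G` gathers the bag and all other children, so exchanging child `i` affects only the second
  -- factor.
  refine ⟨H Z ∩ ⋂ j : {j // j ≠ i}, (c j).eval H, ?_, inter_subset_left, ?_, ?_⟩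
  · exact (hH.defOn Z).inter (DefOn.iInter
      (fun j : {j // j ≠ i} => (h.2.2 j).2.2.2.defOn_eval hH) fun j => (h.2.2 j).2.2.1)
  · rw [eval, key c fun _ _ => rfl]
  · intro t' ht' htop hsize
    refine ⟨node Z Y r (update c i t'), ⟨h.1, h.2.1, fun j => ?_⟩, rfl, ?_, ?_⟩
    · by_cases hj : j = i
      · subst hj
        rw [update_self, htop]
        exact ⟨(h.2.2 j).1, (h.2.2 j).2.1, (h.2.2 j).2.2.1, ht'⟩
      · rw [update_of_ne hj]
        exact h.2.2 j
    · rw [size, size]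
      refine Nat.add_lt_add_left (Finset.sum_lt_sum (fun j _ => ?_) ⟨i, Finset.mem_univ _, ?_⟩) 1
      · by_cases hj : j = i
        · subst hj
          rw [update_self]
          exact hsize.le
        · rw [update_of_ne hj]
      · rwa [update_self]
    · rw [eval, key (update c i t') fun j hj => update_of_ne hj _ _, update_self]

/-- A tall tree that is critical for missing `U` yields a long chain of steps up one of its
branches. `F` is what remains of the constraint when the lower end of the branch is cut off; by
criticality it still meets `U`. In the application, `U` describes the values admitted by the rest of
a minimal unsatisfiable tree, and `B` those admitted by the rest without the root. Intersecting with
`B` keeps the smaller relation non-empty, whereas `U ⊆ B` shows that it is strictly smaller. -/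
theorem reach [Nonempty M] (hunb : IsUnbalanced L M) (hH : IsLocalSystem L n H) (hK : n ≤ K)
    (d : ℕ) : ∀ (t : BagTree V) (U B : Set (V → M)), t.Valid n K → t.top.card = n →
      IsCyl t.top U → DefOn L t.top B → U ⊆ B → ¬ (t.eval H ∩ U).Nonempty →
      (∀ t' : BagTree V, t'.Valid n K → t'.top = t.top → t'.size < t.size →
        (t'.eval H ∩ U).Nonempty) →
      (t.eval H ∩ B).Nonempty → d + 1 ≤ t.height →
      ∃ F, DefOn L t.top F ∧ F ⊆ H t.top ∧ t.eval H ⊆ F ∧ (F ∩ U).Nonempty ∧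
        ∃ y : Fin n → V, Enumerates y t.top ∧
          Reach L d (pull y (F ∩ B), pull y (t.eval H ∩ B)) := by
  induction d with
  | zero =>
    intro t U B ht hcard hU hB hUB hdisj hcrit hne hheight
    refine ⟨H t.top, hH.defOn _, subset_rfl, ht.eval_subset hH, ?_, ?_⟩
    -- Positive height makes the one-node tree with value `H t.top` strictly smaller than `t`, so
    -- criticality applies to it.
    · have hsize : 1 < t.size := by
        cases t with
        | node Z Y r c =>
          have : r ≠ 0 := by
            rintro rfl
            simp [height] at hheight
          have hs : ∀ t : BagTree V, 1 ≤ t.size := by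
            rintro ⟨⟩
            simp [size]
          have hpos : 0 < ∑ i, (c i).size := Finset.sum_pos (fun i _ => hs _)
            ⟨⟨0, Nat.pos_of_ne_zero this⟩, Finset.mem_univ _⟩
          rw [size]
          omega
      have := hcrit (node t.top t.top 0 Fin.elim0)
        ⟨hcard.trans_le hK, subset_rfl, fun i => i.elim0⟩ rfl (by simpa [size] using hsize)
      rwa [eval, iInter_of_empty, inter_univ, (hH.defOn _).isCyl.cyl_eq] at this
    · obtain ⟨y, hy⟩ := exists_enumerates hcard
      exact ⟨y, hy, reach_zero ⟨((hH.defOn _).inter hB).pull hy,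
        ((ht.defOn_eval hH).inter hB).pull hy⟩⟩
  | succ d ih =>
    rintro ⟨Z, Y, r, c⟩ U B ht hcard hU hB hUB hdisj hcrit hne hheight
    change IsCyl Y U at hU
    change DefOn L Y B at hB
    change Y.card = n at hcard
    obtain ⟨i, -, hi⟩ := Finset.lt_sup_iff.1 (Nat.lt_of_succ_le hheight)
    obtain ⟨hci, hciY, hciZ, hcv⟩ := ht.2.2 i
    obtain ⟨G, hG, hGH, hGe, hGr⟩ := exists_side hH ht i
    have hcyl := isCyl_eval (H := H) (c i)
    have hBZ := hB.mono ht.2.1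
    -- Both contexts are pushed down to the child through `G`; a smaller replacement of the child
    -- gives a smaller replacement of the whole tree, so criticality is inherited.
    obtain ⟨F, hF, hFH, heF, hFU, y, hy, hreach⟩ := ih (c i) (cyl (c i).top (G ∩ U))
      (cyl (c i).top (G ∩ B)) hcv hci (isCyl_cyl _ _) ((hG.inter hBZ).cyl hciZ)
      (cyl_mono (inter_subset_inter_right _ hUB))
      (by
        intro h
        rw [inter_comm, cyl_inter_nonempty hcyl] at h
        rw [hGe, cyl_inter_nonempty hU] at hdisj
        refine hdisj ?_
        rwa [inter_assoc, inter_comm U, ← inter_assoc] at h)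
      (by
        intro t' ht' htop hsize
        obtain ⟨t'', h1, h2, h3, h4⟩ := hGr t' ht' htop hsize
        have := hcrit t'' h1 h2 h3
        rw [h4, cyl_inter_nonempty hU] at this
        rw [inter_comm, cyl_inter_nonempty (htop ▸ isCyl_eval t')]
        rwa [inter_assoc, inter_comm U, ← inter_assoc])
      (by
        rw [hGe, cyl_inter_nonempty hB.isCyl] at hne
        rw [inter_comm, cyl_inter_nonempty hcyl]
        rwa [inter_assoc, inter_comm B, ← inter_assoc])
      (by omega)
    have hFZ := hF.mono hciZ
    have hF' : DefOn L Y (cyl Y (G ∩ F)) := (hG.inter hFZ).cyl ht.2.1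
    have hF'H : cyl Y (G ∩ F) ⊆ H Y := (hH.defOn Y).isCyl.cyl_subset
      (inter_subset_left.trans (hGH.trans (hH.anti _ _ ht.2.1)))
    have hsub : (node Z Y r c).eval H ⊆ cyl Y (G ∩ F) := by
      rw [hGe]
      exact cyl_mono (inter_subset_inter_right _ heF)
    have hF'U : (cyl Y (G ∩ F) ∩ U).Nonempty := by
      rw [cyl_inter_nonempty hU]
      rw [inter_comm, cyl_inter_nonempty hF.isCyl] at hFU
      rwa [inter_assoc, inter_comm F, ← inter_assoc]
    refine ⟨cyl Y (G ∩ F), hF', hF'H, hsub, hF'U, ?_⟩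
    -- the relation on the bag that takes the pair of the child to the pair of the node
    obtain ⟨y', hy', hstep⟩ := exists_step (n := n) (y := y) (Z := Z) (E := G ∩ F ∩ B)
      (C := (c i).eval H ∩ cyl (c i).top (G ∩ B)) hy hcard hciY hciZ ht.2.1
      ((hG.inter hFZ).inter hBZ) (hcyl.inter (isCyl_cyl _ _))
    have e1 : cyl (c i).top (G ∩ F ∩ B) = F ∩ cyl (c i).top (G ∩ B) := by
      rw [inter_right_comm, cyl_inter_right hF.isCyl, inter_comm]
    have e2 : cyl Y (G ∩ F ∩ B) = cyl Y (G ∩ F) ∩ B := cyl_inter_right hB.isCyl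
    have e3 : cyl Y (G ∩ F ∩ B ∩ ((c i).eval H ∩ cyl (c i).top (G ∩ B))) =
        (node Z Y r c).eval H ∩ B := by
      have : G ∩ F ∩ B ∩ ((c i).eval H ∩ cyl (c i).top (G ∩ B)) = G ∩ (c i).eval H ∩ B := by
        ext g
        constructor
        · rintro ⟨⟨⟨h1, -⟩, h2⟩, h3, -⟩
          exact ⟨⟨h1, h3⟩, h2⟩
        · rintro ⟨⟨h1, h3⟩, h2⟩
          exact ⟨⟨⟨h1, heF h3⟩, h2⟩, h3, subset_cyl _ _ ⟨h1, h2⟩⟩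
      rw [this, cyl_inter_right hB.isCyl, hGe]
    rw [e1, e2, e3] at hstep
    have hev := ht.defOn_eval hH
    refine ⟨y', hy', hreach.step hunb hstep
      ⟨(hF'.inter hB).pull hy', (hev.inter hB).pull hy'⟩
      (hH.isGoodPair hy' (hF'.inter hB) (hev.inter hB) hne ?_ (inter_subset_left.trans hF'H))⟩
    -- The two relations differ on `U`: the larger one meets it and the smaller one does not.
    refine (inter_subset_inter_left _ hsub).ssubset_of_ne fun heq => hdisj ?_
    obtain ⟨g, hg1, hg2⟩ := hF'U
    have hgB : g ∈ cyl Y (G ∩ F) ∩ B := ⟨hg1, hUB hg2⟩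
    rw [← heq] at hgB
    exact ⟨g, hgB.1, hg2⟩

/-- A bound for the number of variables that are needed to enforce all constraints imposed by trees
of height less than `h`. -/
def varBound (c K : ℕ) : ℕ → ℕ
  | 0 => 0
  | h + 1 => c * (K + 2 ^ K * varBound c K h)

open Classical in
theorem card_bag_union_le {Z : Finset V} (hZ : Z.card ≤ K) {T : Finset V → Finset V} {b : ℕ}
    (hT : ∀ Y, (T Y).card ≤ b) : (Z ∪ (Z.powersetCard n).biUnion T).card ≤ K + 2 ^ K * b := by
  refine (Finset.card_union_le _ _).trans (Nat.add_le_add hZ ?_)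
  refine (Finset.card_biUnion_le_card_mul _ _ b fun Y _ => hT Y).trans
    (Nat.mul_le_mul_right _ ?_)
  calc (Z.powersetCard n).card ≤ Z.powerset.card :=
        Finset.card_le_card fun Y hY => Finset.mem_powerset.2 (Finset.mem_powersetCard.1 hY).1
    _ = 2 ^ Z.card := Finset.card_powerset Z
    _ ≤ 2 ^ K := Nat.pow_le_pow_right (by norm_num) hZ

theorem mem_eval_of_mem {Z Y : Finset V} {r : ℕ} {c : Fin r → BagTree V} {g : V → M}
    (h : g ∈ H Z) (hc : ∀ i, g ∈ (c i).eval H) : g ∈ (node Z Y r c).eval H :=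
  subset_cyl _ _ ⟨h, mem_iInter.2 hc⟩

-- There is no bound on the trees of a given height and top, but their values are definable `n`-ary
-- constraints, of which there are boundedly many. One representative tree per value suffices. Its
-- root bag, together with the supports for lower height of all `n`-subsets of that bag, enforces
-- its value.
open Classical in
theorem exists_support [Nonempty M] (hH : IsLocalSystem L n H)
    (hfin : {R : Set (Fin n → M) | IsCQDefinable L R}.Finite) (h : ℕ) :
    ∀ Y : Finset V, ∃ T : Finset V,
      T.card ≤ varBound {R : Set (Fin n → M) | IsCQDefinable L R}.ncard K h ∧
      (Y.card = n → ∀ t : BagTree V, t.Valid n K → t.top = Y → t.height < h →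
        H T ⊆ t.eval H) := by
  induction h with
  | zero => exact fun Y => ⟨∅, by simp, fun _ t _ _ ht => absurd ht (Nat.not_lt_zero _)⟩
  | succ h ih =>
    intro Y
    by_cases hY : Y.card = n
    swap
    · exact ⟨∅, by simp, fun h => absurd h hY⟩
    choose T hT hTe using ih
    obtain ⟨hdef, hdefc⟩ := finite_defOn (V := V) hfin hY
    let 𝒬 : Set (Set (V → M)) :=
      {Q | ∃ t : BagTree V, t.Valid n K ∧ t.top = Y ∧ t.height < h + 1 ∧ t.eval H = Q}
    have h𝒬 : 𝒬 ⊆ {Q | DefOn L Y Q} := by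
      rintro _ ⟨t, ht, rfl, -, rfl⟩
      exact ht.defOn_eval hH
    have h𝒬fin : 𝒬.Finite := hdef.subset h𝒬
    have : ∀ Q, ∃ t : BagTree V, Q ∈ 𝒬 →
        t.Valid n K ∧ t.top = Y ∧ t.height < h + 1 ∧ t.eval H = Q := by
      intro Q
      by_cases hQ : Q ∈ 𝒬
      · obtain ⟨t, ht⟩ := hQ
        exact ⟨t, fun _ => ht⟩
      · exact ⟨node ∅ ∅ 0 Fin.elim0, fun h => absurd h hQ⟩
    choose t ht using this
    refine ⟨h𝒬fin.toFinset.biUnion fun Q =>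
      (t Q).bag ∪ ((t Q).bag.powersetCard n).biUnion T, ?_, ?_⟩
    · refine (Finset.card_biUnion_le_card_mul _ _ (K + 2 ^ K * varBound _ K h) ?_).trans
        (Nat.mul_le_mul_right _ ?_)
      · intro Q hQ
        exact card_bag_union_le (ht Q (h𝒬fin.mem_toFinset.1 hQ)).1.bag_card hT
      · rw [← ncard_eq_toFinset_card _ h𝒬fin]
        exact (ncard_le_ncard h𝒬 hdef).trans hdefc
    · intro _ s hs hsY hsh g hg
      have hQ : s.eval H ∈ 𝒬 := ⟨s, hs, hsY, hsh, rfl⟩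
      obtain ⟨h1, h2, h3, h4⟩ := ht _ hQ
      have hsub := Finset.subset_biUnion_of_mem (fun Q =>
        (t Q).bag ∪ ((t Q).bag.powersetCard n).biUnion T) (h𝒬fin.mem_toFinset.2 hQ)
      rw [← h4]
      generalize t (s.eval H) = t' at h1 h2 h3 hsub
      obtain ⟨Z, Y', r, c⟩ := t'
      have hgZ := hH.anti _ _ (Finset.union_subset_left hsub) hg
      refine mem_eval_of_mem hgZ fun i => ?_
      obtain ⟨k1, k2, k3, k4⟩ := h1.2.2 i
      have hlt : (c i).height < h := by
        have := Finset.le_sup (f := fun i => (c i).height + 1) (Finset.mem_univ i)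
        rw [height] at h3
        omega
      refine hTe _ k1 _ k4 rfl hlt (hH.anti _ _ ?_ hg)
      exact (Finset.subset_biUnion_of_mem T (Finset.mem_powersetCard.2 ⟨k3, k1⟩)).trans
        (Finset.union_subset_right hsub)

-- In an unsatisfiable tree of minimal size, a tall child would give more pairs on a chain than
-- there are definable pairs. Hence all children are low, and their values are enforced by boundedly
-- many variables, on which `H` has a solution by assumption.
open Classical in
theorem eval_nonempty [Nonempty M] (hunb : IsUnbalanced L M) (hH : IsLocalSystem L n H)
    (hK : n ≤ K) (hfin : {R : Set (Fin n → M) | IsCQDefinable L R}.Finite)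
    (hne : ∀ Z : Finset V, Z.card ≤ K + 2 ^ K *
      varBound {R : Set (Fin n → M) | IsCQDefinable L R}.ncard K
        ((definablePairs L M n).ncard + 1) → (H Z).Nonempty) :
    ∀ t : BagTree V, t.Valid n K → (t.eval H).Nonempty := by
  suffices ∀ s, ∀ t : BagTree V, t.size = s → t.Valid n K → (t.eval H).Nonempty from
    fun t ht => this _ t rfl ht
  intro s
  induction s using Nat.strong_induction_on with
  | _ s ih =>
    rintro t rfl ht
    by_contra hempty
    obtain ⟨Z, Y, r, c⟩ := t
    have hheight : ∀ i, (c i).height < (definablePairs L M n).ncard + 1 := by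
      intro i
      by_contra! hi
      obtain ⟨hci, hciY, hciZ, hcv⟩ := ht.2.2 i
      obtain ⟨G, hG, hGH, hGe, hGr⟩ := exists_side hH ht i
      have hcyl := isCyl_eval (H := H) (c i)
      have hiff : ∀ Q : Set (V → M), IsCyl (c i).top Q →
          ((Q ∩ cyl (c i).top G).Nonempty ↔ (cyl Y (G ∩ Q)).Nonempty) := by
        intro Q hQ
        rw [inter_comm, cyl_inter_nonempty hQ]
        exact ⟨fun h => h.mono (subset_cyl _ _), fun ⟨_, h, hh, _⟩ => ⟨h, hh⟩⟩
      have hlt : (c i).size < (node Z Y r c).size := by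
        rw [size]
        have := Finset.single_le_sum (f := fun i => (c i).size) (fun _ _ => Nat.zero_le _)
          (Finset.mem_univ i)
        omega
      -- With `B = univ` the non-emptiness required by `reach` says that the child alone is
      -- satisfiable, which follows from minimality of the tree.
      obtain ⟨F, -, -, -, -, y, -, hreach⟩ := reach hunb hH hK (definablePairs L M n).ncard (c i)
        (cyl (c i).top G) univ hcv hci (isCyl_cyl _ _) (defOn_univ _) (subset_univ _)
        (by rwa [hiff _ hcyl, ← hGe])
        (by
          intro t' ht' htop hsize
          obtain ⟨t'', h1, h2, h3, h4⟩ := hGr t' ht' htop hsize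
          rw [hiff _ (htop ▸ isCyl_eval t'), ← h4]
          exact ih _ h3 t'' rfl h1)
        (by rw [inter_univ]; exact ih _ hlt _ rfl hcv) hi
      exact lt_irrefl _ (hreach.lt hfin)
    choose T hT hTe using exists_support (K := K) hH hfin ((definablePairs L M n).ncard + 1)
    obtain ⟨g, hg⟩ := hne _ (card_bag_union_le (n := n) ht.1 hT)
    refine hempty ⟨g, mem_eval_of_mem (hH.anti _ _ Finset.subset_union_left hg) fun i => ?_⟩
    obtain ⟨k1, k2, k3, k4⟩ := ht.2.2 i
    refine hTe _ k1 _ k4 rfl (hheight i) (hH.anti _ _ ?_ hg)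
    exact (Finset.subset_biUnion_of_mem T (Finset.mem_powersetCard.2 ⟨k3, k1⟩)).trans
      Finset.subset_union_right

end BagTree

/-- The assignments that satisfy the constraints of `H` on `Z` and those of the family `S` on all
subsets of `Z`. -/
def restrictedBy (H S : Finset V → Set (V → M)) (Z : Finset V) : Set (V → M) :=
  {g | g ∈ H Z ∧ ∀ Y ⊆ Z, g ∈ S Y}

variable (L) in
/-- A family of non-empty definable constraints on sets of `n` variables such that every local
solution on `n` variables extends to all sets of at most `K` variables. -/
structure IsConsistent (n K : ℕ) (H S : Finset V → Set (V → M)) : Prop where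
  defOn : ∀ Y, DefOn L Y (S Y)
  nonempty : ∀ Y, (S Y).Nonempty
  eq_univ : ∀ Y, Y.card ≠ n → S Y = univ
  extend : ∀ Z, Z.card ≤ K → ∀ Y ⊆ Z, Y.card = n → S Y ⊆ cyl Y (restrictedBy H S Z)

-- `S Y` is the conjunction of everything that trees derive about `Y`. Only finitely many
-- constraints on `Y` can be derived, so one tree can use all those on the other `n`-subsets of a
-- bag at once. Hence `S` is closed under further propagation, and it is non-empty because trees are
-- satisfiable.
open Classical in
theorem exists_isConsistent [Nonempty M] (hunb : IsUnbalanced L M) (hH : IsLocalSystem L n H)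
    (hn : 0 < n) (hK : n ≤ K) (hfin : {R : Set (Fin n → M) | IsCQDefinable L R}.Finite)
    (hne : ∀ Z : Finset V, Z.card ≤ K + 2 ^ K *
      BagTree.varBound {R : Set (Fin n → M) | IsCQDefinable L R}.ncard K
        ((definablePairs L M n).ncard + 1) → (H Z).Nonempty) :
    ∃ S, IsConsistent L n K H S := by
  let 𝒬 : Finset V → Set (Set (V → M)) := fun Y =>
    {Q | ∃ t : BagTree V, t.Valid n K ∧ t.top = Y ∧ t.eval H = Q}
  have h𝒬 : ∀ Y, 𝒬 Y ⊆ {Q | DefOn L Y Q} := by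
    rintro Y _ ⟨t, ht, rfl, rfl⟩
    exact ht.defOn_eval hH
  have h𝒬fin : ∀ Y, Y.card = n → (𝒬 Y).Finite := fun Y hY =>
    (finite_defOn hfin hY).1.subset (h𝒬 Y)
  let S : Finset V → Set (V → M) := fun Y => if Y.card = n then ⋂ Q ∈ 𝒬 Y, Q else univ
  have hS : ∀ Y, Y.card = n → S Y = ⋂ Q ∈ 𝒬 Y, Q := fun Y hY => if_pos hY
  have hS' : ∀ Y, Y.card ≠ n → S Y = univ := fun Y hY => if_neg hY
  have hSdef : ∀ Y, DefOn L Y (S Y) := by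
    intro Y
    by_cases hY : Y.card = n
    · rw [hS Y hY]
      obtain ⟨m, ⟨e⟩⟩ := (finite_iff_exists_equiv_fin (α := 𝒬 Y)).1 (h𝒬fin Y hY)
      have := DefOn.iInter (L := L) (Z := Y) (fun i => h𝒬 Y (e.symm i).2) fun _ => subset_rfl
      rw [biInter_eq_iInter]
      rwa [e.symm.surjective.iInter_comp (fun Q : 𝒬 Y => Q.1)] at this
    · rw [hS' Y hY]
      exact defOn_univ Y
  have htree : ∀ Z Y : Finset V, Z.card ≤ K → Y ⊆ Z → ∃ t : BagTree V, t.Valid n K ∧ t.top = Y ∧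
      t.eval H = cyl Y (H Z ∩ {g | ∀ Y' ⊆ Z, Y' ≠ Y → g ∈ S Y'}) := by
    intro Z Y hZ hYZ
    let κ := Σ Y' : {Y' // Y' ∈ (Z.powersetCard n).filter (· ≠ Y)}, 𝒬 Y'.1
    have hκ' : ∀ Y' : {Y' // Y' ∈ (Z.powersetCard n).filter (· ≠ Y)},
        (Y'.1 ⊆ Z ∧ Y'.1.card = n) ∧ Y'.1 ≠ Y := by
      intro Y'
      have := Y'.2
      rwa [Finset.mem_filter, Finset.mem_powersetCard] at this
    have : ∀ Y' : {Y' // Y' ∈ (Z.powersetCard n).filter (· ≠ Y)}, Finite (𝒬 Y'.1) :=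
      fun Y' => h𝒬fin _ (hκ' Y').1.2
    obtain ⟨m, ⟨e⟩⟩ := (finite_iff_exists_equiv_fin (α := κ)).1 inferInstance
    have : ∀ x : κ, ∃ t : BagTree V, t.Valid n K ∧ t.top = x.1.1 ∧ t.eval H = x.2.1 :=
      fun x => x.2.2
    choose t ht1 ht2 ht3 using this
    refine ⟨.node Z Y m fun i => t (e.symm i), ⟨hZ, hYZ, fun i => ?_⟩, rfl, ?_⟩
    · rw [ht2]
      obtain ⟨⟨h1, h2⟩, h3⟩ := hκ' (e.symm i).1
      exact ⟨h2, h3, h1, ht1 _⟩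
    · rw [BagTree.eval]
      congr 2
      ext g
      rw [e.symm.surjective.iInter_comp (fun x : κ => (t x).eval H)]
      simp only [mem_iInter, mem_ofPred_eq]
      constructor
      · intro h Y' hY' hne
        by_cases hcard : Y'.card = n
        · rw [hS Y' hcard]
          refine mem_iInter₂.2 fun Q hQ => ?_
          have := h ⟨⟨Y', Finset.mem_filter.2 ⟨Finset.mem_powersetCard.2 ⟨hY', hcard⟩, hne⟩⟩,
            ⟨Q, hQ⟩⟩
          rwa [ht3] at this
        · rw [hS' Y' hcard]
          trivial
      · intro h x
        obtain ⟨⟨h1, h2⟩, h3⟩ := hκ' x.1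
        have := h x.1.1 h1 h3
        rw [hS _ h2] at this
        rw [ht3]
        exact mem_iInter₂.1 this _ x.2.2
  refine ⟨S, hSdef, fun Y => ?_, hS', fun Z hZ Y hYZ hY g hg => ?_⟩
  · by_cases hY : Y.card = n
    -- With top `∅`, which differs from `Y` as `n > 0`, the constraint on `Y` itself is among the
    -- children.
    · obtain ⟨t, ht, -, hte⟩ := htree Y ∅ (hY.trans_le hK) (Finset.empty_subset _)
      have := BagTree.eval_nonempty hunb hH hK hfin hne t ht
      rw [hte] at this
      obtain ⟨-, h, ⟨-, hh⟩, -⟩ := this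
      refine ⟨h, hh Y subset_rfl ?_⟩
      rintro rfl
      simp at hY
      omega
    · rw [hS' Y hY]
      exact univ_nonempty
  · obtain ⟨t, ht, hty, hte⟩ := htree Z Y hZ hYZ
    have hgt : g ∈ t.eval H := by
      rw [hS Y hY] at hg
      exact mem_iInter₂.1 hg _ ⟨t, ht, hty, rfl⟩
    rw [hte] at hgt
    obtain ⟨h, ⟨hhH, hh⟩, hgh⟩ := hgt
    refine ⟨h, ⟨hhH, fun Y' hY' => ?_⟩, hgh⟩
    by_cases hne : Y' = Y
    · subst hne
      exact (hSdef Y').isCyl hgh.symm hg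
    · exact hh Y' hY' hne

theorem IsConsistent.defOn_restrictedBy [Nonempty M] [Finite V] (hH : IsLocalSystem L n H)
    {S : Finset V → Set (V → M)} (hS : IsConsistent L n K H S) (Z : Finset V) :
    DefOn L Z (restrictedBy H S Z) := by
  have h : restrictedBy H S Z = H Z ∩ ⋂ Y : {Y : Finset V // Y ⊆ Z}, S Y := by
    ext g
    simp [restrictedBy]
  rw [h]
  exact (hH.defOn Z).inter (DefOn.iInter (fun Y : {Y : Finset V // Y ⊆ Z} => hS.defOn Y)
    fun Y => Y.2)

theorem IsConsistent.cyl_restrictedBy {S : Finset V → Set (V → M)}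
    (hS : IsConsistent L n K H S) {Y Z : Finset V} (hZ : Z.card ≤ K) (hYZ : Y ⊆ Z)
    (hY : Y.card = n) : cyl Y (restrictedBy H S Z) = S Y :=
  ((hS.defOn Y).isCyl.cyl_subset fun _ hg => hg.2 Y hYZ).antisymm (hS.extend Z hZ Y hYZ hY)

-- A consistent family that is minimal under inclusion is taken. If some `S Y` had a smaller
-- non-empty definable `C`, then either a bag transports `C` to a proper subset of another `S Y'`,
-- which is a step, or `S Y` can be replaced by `C`, contradicting minimality. Thus steps could be
-- continued forever, against the bound on chains.
open Classical in
theorem exists_isConsistent_minDef [Nonempty M] [Finite V] (hunb : IsUnbalanced L M)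
    (hH : IsLocalSystem L n H) (hK : n ≤ K)
    (hfin : {R : Set (Fin n → M) | IsCQDefinable L R}.Finite)
    (hex : ∃ S, IsConsistent L n K H S) :
    ∃ S, IsConsistent L n K H S ∧ ∀ Y, Y.card = n → MinDef L Y (S Y) := by
  have hfinS : {S | IsConsistent L n K H S}.Finite := by
    refine (Finite.pi' (t := fun Y : Finset V =>
      if Y.card = n then {Q : Set (V → M) | DefOn L Y Q} else {univ}) fun Y => ?_).subset ?_
    · by_cases hY : Y.card = n
      · simpa [hY] using (finite_defOn hfin hY).1
      · simp [hY]
    · intro S hS Y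
      by_cases hY : Y.card = n
      · simpa [hY] using hS.defOn Y
      · simpa [hY] using hS.eq_univ Y hY
  obtain ⟨S, hSmin⟩ := hfinS.exists_minimal hex
  have hS : IsConsistent L n K H S := hSmin.1
  refine ⟨S, hS, ?_⟩
  by_contra! hnot
  obtain ⟨Y₀, hY₀, hnot⟩ := hnot
  have hSH : ∀ Y, Y.card = n → S Y ⊆ H Y := by
    intro Y hY
    rw [← hS.cyl_restrictedBy (hY.trans_le hK) subset_rfl hY]
    exact (hH.defOn Y).isCyl.cyl_subset fun g hg => hg.1
  have hwalk : ∀ d, ∃ (Y : Finset V) (C : Set (V → M)) (y : Fin n → V), Y.card = n ∧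
      DefOn L Y C ∧ C.Nonempty ∧ C ⊂ S Y ∧ Enumerates y Y ∧
      Reach L d (pull y (S Y), pull y C) := by
    intro d
    induction d with
    | zero =>
      have : ∃ C ⊆ S Y₀, DefOn L Y₀ C ∧ C.Nonempty ∧ C ≠ S Y₀ := by
        by_contra! h
        exact hnot ⟨hS.defOn _, hS.nonempty _, h⟩
      obtain ⟨C, hCS, hC, hne, hCne⟩ := this
      obtain ⟨y, hy⟩ := exists_enumerates hY₀
      exact ⟨Y₀, C, y, hY₀, hC, hne, hCS.ssubset_of_ne hCne, hy,
        reach_zero ⟨(hS.defOn _).pull hy, hC.pull hy⟩⟩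
    | succ d ih =>
      obtain ⟨Y, C, y, hY, hC, hne, hCS, hy, hreach⟩ := ih
      -- If no bag transports `C` to a proper subset, `update S Y C` is again consistent.
      by_cases hsink : ∃ Z Y' : Finset V, Z.card ≤ K ∧ Y ⊆ Z ∧ Y' ⊆ Z ∧ Y'.card = n ∧ Y ≠ Y' ∧
          cyl Y' (restrictedBy H S Z ∩ C) ≠ S Y'
      · obtain ⟨Z, Y', hZ, hYZ, hYZ', hY', hYY', hC'⟩ := hsink
        have hE := hS.defOn_restrictedBy hH Z
        obtain ⟨y', hy', hstep⟩ := exists_step hy hY' hYY' hYZ hYZ' hE hC.isCyl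
        rw [hS.cyl_restrictedBy hZ hYZ hY, hS.cyl_restrictedBy hZ hYZ' hY'] at hstep
        have hC'def : DefOn L Y' (cyl Y' (restrictedBy H S Z ∩ C)) :=
          (hE.inter (hC.mono hYZ)).cyl hYZ'
        have hC'ss : cyl Y' (restrictedBy H S Z ∩ C) ⊂ S Y' := by
          exact ((cyl_mono inter_subset_left).trans
            (hS.cyl_restrictedBy hZ hYZ' hY').subset).ssubset_of_ne hC'
        have hC'ne : (cyl Y' (restrictedBy H S Z ∩ C)).Nonempty := by
          obtain ⟨g, hg⟩ := hne
          obtain ⟨h, hh, hgh⟩ := hS.extend Z hZ Y hYZ hY (hCS.subset hg)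
          exact ⟨h, subset_cyl _ _ ⟨hh, hC.isCyl hgh.symm hg⟩⟩
        exact ⟨Y', _, y', hY', hC'def, hC'ne, hC'ss, hy', hreach.step hunb hstep
          ⟨(hS.defOn _).pull hy', hC'def.pull hy'⟩
          (hH.isGoodPair hy' (hS.defOn _) hC'def hC'ne hC'ss (hSH Y' hY'))⟩
      · exfalso
        push Not at hsink
        have hle : update S Y C ≤ S := by
          intro Y'
          by_cases h : Y' = Y
          · subst h
            rw [update_self]
            exact hCS.subset
          · rw [update_of_ne h]
        have hcons : IsConsistent L n K H (update S Y C) := by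
          refine ⟨fun Y' => ?_, fun Y' => ?_, fun Y' hY' => ?_, fun Z hZ Y' hYZ' hY' => ?_⟩
          · by_cases h : Y' = Y
            · subst h; rwa [update_self]
            · rw [update_of_ne h]; exact hS.defOn Y'
          · by_cases h : Y' = Y
            · subst h; rwa [update_self]
            · rw [update_of_ne h]; exact hS.nonempty Y'
          · have h : Y' ≠ Y := by rintro rfl; exact hY' hY
            rw [update_of_ne h]; exact hS.eq_univ Y' hY'
          · by_cases hYZ : Y ⊆ Z
            · have hsub : restrictedBy H S Z ∩ C ⊆ restrictedBy H (update S Y C) Z := by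
                rintro g ⟨⟨h1, h2⟩, h3⟩
                refine ⟨h1, fun Y'' hY'' => ?_⟩
                by_cases h : Y'' = Y
                · subst h; rwa [update_self]
                · rw [update_of_ne h]; exact h2 Y'' hY''
              refine Subset.trans ?_ (cyl_mono hsub)
              by_cases h : Y' = Y
              · subst h
                rw [update_self, cyl_inter_right hC.isCyl, hS.cyl_restrictedBy hZ hYZ hY]
                exact subset_inter hCS.subset subset_rfl
              · rw [update_of_ne h, hsink Z Y' hZ hYZ hYZ' hY' (Ne.symm h)]
            · have h : Y' ≠ Y := by rintro rfl; exact hYZ hYZ'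
              rw [update_of_ne h]
              refine (hS.extend Z hZ Y' hYZ' hY').trans (cyl_mono ?_)
              rintro g ⟨h1, h2⟩
              refine ⟨h1, fun Y'' hY'' => ?_⟩
              have h : Y'' ≠ Y := by rintro rfl; exact hYZ hY''
              rw [update_of_ne h]
              exact h2 Y'' hY''
        have := hSmin.2 hcons hle Y
        rw [update_self] at this
        exact hCS.not_subset this
  obtain ⟨Y, C, y, -, -, -, -, -, hreach⟩ := hwalk (definablePairs L M n).ncard
  exact lt_irrefl _ (hreach.lt hfin)

end LocalSystems

/-! ### Raising the arity of the minimal constraints -/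

section Levels

variable {L : FirstOrder.Language.{u, v}} {M : Type w} [L.Structure M] {V : Type} [L.Structure V]

/-- The assignments that respect all relations between elements of `Z` and satisfy the constraints
`R X` on all sets `X ⊆ Z` with at most `m` elements. -/
def localSols (L : FirstOrder.Language.{u, v}) {M : Type w} [L.Structure M] {V : Type}
    [L.Structure V] (m : ℕ) (R : Finset V → Set (V → M)) (Z : Finset V) : Set (V → M) :=
  {g | (∀ (r : ℕ) (A : L.Relations r) (x : Fin r → V), (∀ i, x i ∈ Z) →
      FirstOrder.Language.Structure.RelMap A x → FirstOrder.Language.Structure.RelMap A (g ∘ x)) ∧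
    ∀ X ⊆ Z, X.card ≤ m → g ∈ R X}

variable (L M V) in
/-- There are minimal constraints on all sets with at most `m` elements that are locally
satisfiable on all sets with at most `K` elements. -/
def HasLevel (m K : ℕ) : Prop :=
  ∃ R : Finset V → Set (V → M), (∀ X, X.card ≤ m → MinDef L X (R X)) ∧
    ∀ Z : Finset V, Z.card ≤ K → (localSols L m R Z).Nonempty

theorem localSols_anti {m : ℕ} {R : Finset V → Set (V → M)} {Y Z : Finset V} (h : Y ⊆ Z) :
    localSols L m R Z ⊆ localSols L m R Y :=
  fun _ hg => ⟨fun r A x hx => hg.1 r A x fun i => h (hx i), fun X hX => hg.2 X (hX.trans h)⟩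

theorem defOn_localSols [Nonempty M] [Finite V] [Finite (Σ r, L.Relations r)] {m : ℕ}
    {R : Finset V → Set (V → M)} (hR : ∀ X, X.card ≤ m → MinDef L X (R X)) (Z : Finset V) :
    DefOn L Z (localSols L m R Z) := by
  have h : localSols L m R Z =
      (⋂ p : {p : Σ A : (Σ r, L.Relations r), Fin A.1 → V // (∀ i, p.2 i ∈ Z) ∧
        FirstOrder.Language.Structure.RelMap p.1.2 p.2},
        {g : V → M | FirstOrder.Language.Structure.RelMap p.1.1.2 (g ∘ p.1.2)}) ∩
      ⋂ X : {X : Finset V // X ⊆ Z ∧ X.card ≤ m}, R X := by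
    ext g
    simp only [localSols, mem_ofPred_eq, mem_inter_iff, mem_iInter, Subtype.forall, Sigma.forall,
      and_imp]
  rw [h]
  exact (DefOn.iInter (X := fun _ => Z) (fun p => defOn_atom _ _ p.2.1) fun _ => subset_rfl).inter
    (DefOn.iInter (fun X : {X : Finset V // X ⊆ Z ∧ X.card ≤ m} => (hR X X.2.2).defOn)
      fun X => X.2.1)

/-- The local solutions for level `m` form a local system for arity `m + 1`, and the number of
variables assumed is the one needed to make all trees with bags of size `K` satisfiable. The minimal
consistent family then supplies the constraints on `m + 1` variables. -/
theorem HasLevel.succ_of_le [Nonempty M] [Finite V] [Finite (Σ r, L.Relations r)]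
    (hunb : IsUnbalanced L M) {m K : ℕ}
    (hfin : {R : Set (Fin (m + 1) → M) | IsCQDefinable L R}.Finite) (hK : m + 1 ≤ K)
    (h : HasLevel L M V m (K + 2 ^ K *
      BagTree.varBound {R : Set (Fin (m + 1) → M) | IsCQDefinable L R}.ncard K
        ((definablePairs L M (m + 1)).ncard + 1))) : HasLevel L M V (m + 1) K := by
  classical
  obtain ⟨R, hR, hne⟩ := h
  have hH : IsLocalSystem L (m + 1) (localSols (M := M) (V := V) L m R) :=
    ⟨defOn_localSols hR, fun Y Z => localSols_anti, fun X hX => ⟨R X, hR X (by omega),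
      fun g hg => hg.2 X subset_rfl (by omega)⟩⟩
  obtain ⟨S, hS, hmin⟩ := exists_isConsistent_minDef hunb hH hK hfin
    (exists_isConsistent hunb hH (Nat.succ_pos m) hK hfin hne)
  refine ⟨fun X => if X.card = m + 1 then S X else R X, fun X hX => ?_, fun Z hZ => ?_⟩
  · dsimp only
    split_ifs with h
    · exact hmin X h
    · exact hR X (by omega)
  · have : (restrictedBy (localSols L m R) S Z).Nonempty := by
      by_cases hcard : m + 1 ≤ Z.card
      · obtain ⟨Y, hYZ, hY⟩ := Finset.exists_subset_card_eq hcard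
        obtain ⟨g, hg⟩ := hS.nonempty Y
        obtain ⟨k, hk, -⟩ := hS.extend Z hZ Y hYZ hY hg
        exact ⟨k, hk⟩
      · obtain ⟨g, hg⟩ := hne Z (by omega)
        refine ⟨g, hg, fun Y hY => ?_⟩
        have := Finset.card_le_card hY
        rw [hS.eq_univ Y (by omega)]
        trivial
    obtain ⟨g, hg, hgS⟩ := this
    refine ⟨g, hg.1, fun X hX hXm => ?_⟩
    dsimp only
    split_ifs with h
    · exact hgS X hX
    · exact hg.2 X hX (by omega)

theorem HasLevel.mono {m K K' : ℕ} (hK : K ≤ K') (h : HasLevel L M V m K') :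
    HasLevel L M V m K := by
  obtain ⟨R, hR, hne⟩ := h
  exact ⟨R, hR, fun Z hZ => hne Z (hZ.trans hK)⟩

end Levels

end FiniteDuality

namespace FiniteDuality

open Function Set
open FirstOrder.Language.Structure (RelMap)

universe u v u' v' w

/-! ### Definable relations, orbits, and the core property -/

section Orbits

variable {L : FirstOrder.Language.{u, v}} {L' : FirstOrder.Language.{u', v'}} {M : Type w}
  [L.Structure M] [L'.Structure M]

variable (L L' M) in
/-- All automorphisms of the `L`-structure `M` preserve the relations of `L'`. -/
def PreservedByAut : Prop :=
  ∀ (σ : M ≃[L] M) (r : ℕ) (A : L'.Relations r) (a : Fin r → M), RelMap A a → RelMap A (σ ∘ a)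

theorem IsFirstOrderExpansion.preservedByAut {ι : L →ᴸ L'} (h : IsFirstOrderExpansion ι M) :
    PreservedByAut L L' M := by
  intro σ r A a ha
  obtain ⟨φ, hφ⟩ := Set.empty_definable_iff.1 (h.definable r A)
  have h1 : ∀ b : Fin r → M, RelMap A b ↔ φ.Realize b := fun b => Set.ext_iff.1 hφ b
  rw [h1] at ha ⊢
  exact (FirstOrder.Language.StrongHomClass.realize_formula σ φ).2 ha

theorem IsCQDefinable.comp_mem (hinv : PreservedByAut L L' M) {α : Type} {R : Set (α → M)}
    (hR : IsCQDefinable L' R) (σ : M ≃[L] M) {a : α → M} (ha : a ∈ R) : σ ∘ a ∈ R := by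
  obtain ⟨X, _, S, p, -, -, rfl⟩ := hR
  obtain ⟨f, hf, rfl⟩ := ha
  exact ⟨σ ∘ f, fun s hs => hinv σ _ _ _ (hf s hs), rfl⟩

theorem DefOn.comp_mem (hinv : PreservedByAut L L' M) {V : Type} {X : Finset V}
    {R : Set (V → M)} (hR : DefOn L' X R) (σ : M ≃[L] M) {g : V → M} (hg : g ∈ R) :
    σ ∘ g ∈ R := by
  obtain ⟨Q, hQ, rfl⟩ := hR
  exact hQ.comp_mem hinv σ hg

/-- In a homogeneous relational structure, finite tuples with the same atomic type lie in the same
orbit. -/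
theorem exists_aut_of_same_type [L.IsRelational] (hhom : L.IsUltrahomogeneous M) {n : ℕ}
    {a b : Fin n → M} (heq : ∀ i j, a i = a j ↔ b i = b j)
    (hrel : ∀ (r : ℕ) (A : L.Relations r) (x : Fin r → Fin n),
      RelMap A (a ∘ x) ↔ RelMap A (b ∘ x)) : SameOrbit L M a b := by
  let S : L.Substructure M := ⟨range a, fun f => isEmptyElim f⟩
  have hS : S.FG := by
    have : Finite S := (finite_range a).to_subtype
    exact FirstOrder.Language.Substructure.FG.of_finite
  choose s hs using fun m : S => m.2
  have hba : ∀ m : S, ∀ i, a i = m → b (s m) = b i := by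
    intro m i hi
    rw [← heq, hs, hi]
  let f : S ↪[L] M :=
    { toFun := fun m => b (s m)
      inj' := by
        intro m m' h
        have h : b (s m) = b (s m') := h
        rw [← heq, hs, hs] at h
        exact Subtype.ext h
      map_fun' := fun f => isEmptyElim f
      map_rel' := by
        intro r A x
        change RelMap A (b ∘ fun i => s (x i)) ↔ RelMap A (fun i => (x i : M))
        rw [← hrel]
        have : (a ∘ fun i => s (x i)) = fun i => (x i : M) := funext fun i => hs (x i)
        rw [this] }
  obtain ⟨g, hg⟩ := hhom S hS f
  refine ⟨g, fun i => ?_⟩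
  have h1 : f ⟨a i, mem_range_self i⟩ = g (a i) := by
    rw [hg]
    rfl
  rw [← h1]
  exact hba ⟨a i, mem_range_self i⟩ i rfl

/-- Definable relations are unions of orbits, and by homogeneity an orbit is determined by the
equalities and the finitely many atomic relations among the entries. -/
theorem finite_isCQDefinable [L.IsRelational] [Finite (Σ r, L.Relations r)]
    (hhom : L.IsUltrahomogeneous M) (hinv : PreservedByAut L L' M) (n : ℕ) :
    {R : Set (Fin n → M) | IsCQDefinable L' R}.Finite := by
  let τ : (Fin n → M) →
      Set (Fin n × Fin n) × Set (Σ A : (Σ r, L.Relations r), Fin A.1 → Fin n) :=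
    fun a => ({p | a p.1 = a p.2}, {p | RelMap p.1.2 (a ∘ p.2)})
  have hτ : ∀ a b, τ a = τ b → SameOrbit L M a b := by
    intro a b hab
    have h1 := congrArg Prod.fst hab
    have h2 := congrArg Prod.snd hab
    exact exists_aut_of_same_type hhom (fun i j => Set.ext_iff.1 h1 (i, j))
      fun r A x => Set.ext_iff.1 h2 ⟨⟨r, A⟩, x⟩
  refine Finite.of_injOn (f := fun R => τ '' R) (t := univ) (fun _ _ => mem_univ _) ?_
    (Set.toFinite _)
  have key : ∀ R R' : Set (Fin n → M), IsCQDefinable L' R' → τ '' R = τ '' R' → R ⊆ R' := by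
    intro R R' hR' h a ha
    have : τ a ∈ τ '' R' := h ▸ mem_image_of_mem τ ha
    obtain ⟨b, hb, hba⟩ := this
    obtain ⟨σ, hσ⟩ := hτ b a hba
    have : σ ∘ b = a := funext hσ
    exact this ▸ hR'.comp_mem hinv σ hb
  exact fun R hR R' hR' h => (key R R' hR' h).antisymm (key R' R hR h.symm)

variable (L') in
/-- The map `e` preserves all definable relations between the elements of `S`. -/
def PreservesOn (S : Finset M) (e : M → M) : Prop :=
  ∀ (n : ℕ) (x : Fin n → M), (∀ i, x i ∈ S) → ∀ R : Set (Fin n → M), IsCQDefinable L' R →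
    x ∈ R → e ∘ x ∈ R

/-- Tuples over `S` arise from `a` by choosing and repeating entries, and definable relations are
closed under the corresponding identification of variables. -/
theorem preservesOn_of_tuple {n : ℕ} {a : Fin n → M} {S : Finset M} (ha : ∀ x ∈ S, ∃ i, a i = x)
    {e : M → M} (h : ∀ R : Set (Fin n → M), IsCQDefinable L' R → a ∈ R → e ∘ a ∈ R) :
    PreservesOn L' S e := by
  intro m x hx R hR hxR
  choose s hs using fun i => ha (x i) (hx i)
  have hsx : a ∘ s = x := funext hs
  have := h _ (IsCQDefinable.glue (κ := Unit) (fun _ => hR) (fun _ => s) (p := id) injective_id)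
    ⟨a, fun _ => hsx ▸ hxR, rfl⟩
  obtain ⟨g, hg, hge⟩ := this
  rw [← hsx, ← comp_assoc, ← hge]
  exact hg ()

open Classical in
theorem PreservesOn.exists_insert (hfin : ∀ n, {R : Set (Fin n → M) | IsCQDefinable L' R}.Finite)
    {S : Finset M} {e : M → M} (h : PreservesOn L' S e) (c : M) :
    ∃ e' : M → M, (∀ x ∈ S, e' x = e x) ∧ PreservesOn L' (insert c S) e' := by
  by_cases hc : c ∈ S
  · exact ⟨e, fun _ _ => rfl, by rwa [Finset.insert_eq_of_mem hc]⟩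
  let n := S.card
  let a : Fin n → M := fun i => S.equivFin.symm i
  have haS : ∀ i, a i ∈ S := fun i => (S.equivFin.symm i).2
  have hSa : ∀ x ∈ S, ∃ i, a i = x := fun x hx => ⟨S.equivFin ⟨x, hx⟩, by simp [a]⟩
  let b : Fin (n + 1) → M := Fin.snoc a c
  let 𝒬 := {R : Set (Fin (n + 1) → M) | IsCQDefinable L' R ∧ b ∈ R}
  have h𝒬 : 𝒬.Finite := (hfin (n + 1)).subset fun R hR => hR.1
  obtain ⟨m, ⟨ε⟩⟩ := (finite_iff_exists_equiv_fin (α := 𝒬)).1 h𝒬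
  -- The conjunction of all definable relations that hold for `b`, with the entry `c` quantified
  -- away. It holds for `a`, hence for its image under `e`, and the witness is the value for `c`.
  have hD := IsCQDefinable.glue (fun i => (ε.symm i).2.1) (fun _ => id)
    (p := Fin.castSucc) (Fin.castSucc_injective n)
  have := h n a haS _ hD ⟨b, fun i => (ε.symm i).2.2, by funext i; simp [b]⟩
  obtain ⟨g, hg, hge⟩ := this
  refine ⟨update e c (g (Fin.last n)), fun x hx => update_of_ne (by rintro rfl; exact hc hx) _ _, ?_⟩
  refine preservesOn_of_tuple (a := b) ?_ ?_
  · intro x hx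
    rcases Finset.mem_insert.1 hx with rfl | hx
    · exact ⟨Fin.last n, by simp [b]⟩
    · obtain ⟨i, rfl⟩ := hSa x hx
      exact ⟨i.castSucc, by simp [b]⟩
  · intro R hR hbR
    have h1 := hg (ε ⟨R, hR, hbR⟩)
    rw [Equiv.symm_apply_apply] at h1
    convert h1 using 1
    funext i
    refine Fin.lastCases ?_ (fun i => ?_) i
    · simp [b]
    · have h2 : a i ≠ c := fun h => hc (h ▸ haS i)
      have := congrFun hge i
      simp only [comp_apply] at this
      simp [b, update_of_ne h2, this]

/-- A map that preserves the definable relations on a finite set extends to an endomorphism. -/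
theorem PreservesOn.exists_hom [L'.IsRelational] [Countable M] [Nonempty M]
    (hfin : ∀ n, {R : Set (Fin n → M) | IsCQDefinable L' R}.Finite)
    {S : Finset M} {e : M → M} (h : PreservesOn L' S e) :
    ∃ f : M →[L'] M, ∀ x ∈ S, f x = e x := by
  classical
  obtain ⟨enum, henum⟩ := exists_surjective_nat M
  choose next hnext hnext' using
    fun (p : {p : Finset M × (M → M) // PreservesOn L' p.1 p.2}) (c : M) =>
      p.2.exists_insert hfin c
  -- Elements of `M` are added one at a time along an enumeration; only the forth direction is
  -- needed, since an endomorphism suffices.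
  let seq : ℕ → {p : Finset M × (M → M) // PreservesOn L' p.1 p.2} := fun n =>
    Nat.rec ⟨(S, e), h⟩ (fun i p => ⟨(insert (enum i) p.1.1, next p (enum i)), hnext' p _⟩) n
  have hsucc : ∀ i, (seq (i + 1)).1.1 = insert (enum i) (seq i).1.1 := fun i => rfl
  have hmono : Monotone fun i => (seq i).1.1 := by
    refine monotone_nat_of_le_succ fun i => ?_
    rw [hsucc]
    exact Finset.subset_insert _ _
  have hagree : ∀ i j, i ≤ j → ∀ x ∈ (seq i).1.1, (seq j).1.2 x = (seq i).1.2 x := by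
    intro i j hij
    induction j, hij using Nat.le_induction with
    | base => exact fun _ _ => rfl
    | succ j hij ih =>
      intro x hx
      rw [← ih x hx]
      exact hnext (seq j) (enum j) x (hmono hij hx)
  have hcover : ∀ x : M, ∃ i, x ∈ (seq i).1.1 := by
    intro x
    obtain ⟨i, rfl⟩ := henum x
    exact ⟨i + 1, by rw [hsucc]; exact Finset.mem_insert_self _ _⟩
  choose idx hidx using hcover
  refine ⟨{ toFun := fun x => (seq (idx x)).1.2 x
            map_fun' := fun f => isEmptyElim f
            map_rel' := ?_ }, fun x hx => hagree 0 _ (Nat.zero_le _) x hx⟩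
  intro r A x hx
  let N := Finset.univ.sup fun i => idx (x i)
  have hN : ∀ i, idx (x i) ≤ N := fun i => Finset.le_sup (f := fun i => idx (x i))
    (Finset.mem_univ i)
  have h1 : (fun x => (seq (idx x)).1.2 x) ∘ x = (seq N).1.2 ∘ x :=
    funext fun i => (hagree _ _ (hN i) _ (hidx _)).symm
  rw [h1]
  refine (seq N).2 r x (fun i => hmono (hN i) (hidx _)) {a | RelMap A a} ?_ hx
  refine ⟨Fin r, inferInstance, {⟨r, A, id⟩}, id, finite_singleton _, injective_id, ?_⟩
  ext a
  simp [Models, Atom.Holds]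

theorem IsModelCompleteCore.exists_aut [L'.IsRelational] [Countable M] [Nonempty M]
    {ι : L →ᴸ L'} (hexp : IsFirstOrderExpansion ι M) [L.IsRelational]
    (hcore : IsModelCompleteCore L M)
    (hfin : ∀ n, {R : Set (Fin n → M) | IsCQDefinable L' R}.Finite)
    {S : Finset M} {e : M → M} (h : PreservesOn L' S e) :
    ∃ σ : M ≃[L] M, ∀ x ∈ S, σ x = e x := by
  obtain ⟨f, hf⟩ := h.exists_hom hfin
  have := hexp.isExpansionOn
  let f' : M →[L] M :=
    { toFun := f
      map_fun' := fun f => isEmptyElim f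
      map_rel' := fun A x hx => by
        rw [← ι.map_onRelation] at hx ⊢
        exact f.map_rel _ _ hx }
  obtain ⟨σ, hσ⟩ := hcore f' S
  exact ⟨σ, fun x hx => (hσ x hx).trans (hf x hx)⟩

open Classical in
/-- The elements of a minimal definable constraint all lie in the orbit of any of its injective
elements. -/
theorem MinDef.exists_aut_of_injOn [L'.IsRelational] [Countable M] [Nonempty M] {ι : L →ᴸ L'}
    (hexp : IsFirstOrderExpansion ι M) [L.IsRelational] (hcore : IsModelCompleteCore L M)
    (hfin : ∀ n, {R : Set (Fin n → M) | IsCQDefinable L' R}.Finite) {V : Type} {X : Finset V}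
    {R : Set (V → M)} (hR : MinDef L' X R) {g h : V → M} (hg : g ∈ R) (hh : h ∈ R)
    (hinj : InjOn g X) : ∃ σ : M ≃[L] M, ∀ x ∈ X, σ (g x) = h x := by
  obtain ⟨y, hy⟩ := exists_enumerates (rfl : X.card = X.card)
  have hyX : ∀ i, y i ∈ X := fun i => by
    rw [← Finset.mem_coe, ← hy.2]; exact mem_range_self i
  have hXy : ∀ x ∈ X, ∃ i, y i = x := fun x hx => by
    rw [← Finset.mem_coe, ← hy.2] at hx; exact hx
  have hgy : Injective (g ∘ y) := fun i j hij =>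
    hy.1 (hinj (Finset.mem_coe.2 (hyX i)) (Finset.mem_coe.2 (hyX j)) hij)
  let e : M → M := extend (g ∘ y) (h ∘ y) id
  have he : e ∘ (g ∘ y) = h ∘ y := extend_comp hgy _ _
  have hpres : PreservesOn L' (X.image g) e := by
    refine preservesOn_of_tuple (a := g ∘ y) ?_ ?_
    · intro z hz
      obtain ⟨x, hx, rfl⟩ := Finset.mem_image.1 hz
      obtain ⟨i, rfl⟩ := hXy x hx
      exact ⟨i, rfl⟩
    · intro Q hQ hgQ
      rw [he]
      have hQX : DefOn L' X {k : V → M | k ∘ y ∈ Q} := by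
        have := IsCQDefinable.glue (κ := Unit) (fun _ => hQ) (β := X)
          (fun _ i => ⟨y i, hyX i⟩) (p := id) injective_id
        refine ⟨_, this, ?_⟩
        ext k
        simp only [comp_id, mem_ofPred_eq, exists_eq_right, forall_const]
        rfl
      -- By minimality, a definable relation that holds for `g` holds on all of `R`, in particular
      -- for `h`.
      have := hR.eq_of_subset _ inter_subset_left (hR.defOn.inter hQX) ⟨g, hg, hgQ⟩
      exact (this.ge hh).2
  obtain ⟨σ, hσ⟩ := hcore.exists_aut hexp hfin hpres
  refine ⟨σ, fun x hx => ?_⟩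
  rw [hσ _ (Finset.mem_image_of_mem g hx)]
  obtain ⟨i, rfl⟩ := hXy x hx
  exact congrFun he i

end Orbits

/-! ### Definable subsets of the diagonal -/

section Equality

variable {L : FirstOrder.Language.{u, v}} {M : Type w} [L.Structure M]

/-- In an unbalanced structure, a definable set of pairs of equal elements has at most one
element. -/
theorem IsUnbalanced.subsingleton_of_diagonal [Nonempty M] (hunb : IsUnbalanced L M)
    {D : Set (Fin 2 → M)} (hD : IsCQDefinable L D) (hdiag : ∀ a ∈ D, a 0 = a 1) :
    D.Subsingleton := by
  by_contra hnot
  rw [not_subsingleton_iff] at hnot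
  obtain ⟨a₀, ha₀, b₀, hb₀, hab⟩ := hnot
  have hconst : ∀ a ∈ D, (fun _ => a 0) ∈ D := by
    intro a ha
    convert ha using 1
    funext i
    fin_cases i
    · rfl
    · exact hdiag a ha
  -- `W` is the square of the projection of `D`. Each coordinate of a pair in `W` extends to a pair
  -- in `D`, so `(W, D)` is good once `D` has two elements.
  let W : Set (Fin 2 → M) := {a | (fun _ => a 0) ∈ D ∧ (fun _ => a 1) ∈ D}
  have hDW : D ⊆ W := fun a ha => ⟨hconst a ha, hdiag a ha ▸ hconst a ha⟩
  have hgood : IsGoodPair L (W, D) := by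
    refine ⟨hD, ⟨a₀, ha₀⟩, (hDW.ssubset_of_ne fun h => hab ?_), fun a ha Z hZ => ?_⟩
    · have hmem : ![a₀ 0, b₀ 0] ∈ W := ⟨hconst a₀ ha₀, hconst b₀ hb₀⟩
      rw [← h] at hmem
      have h0 : a₀ 0 = b₀ 0 := hdiag _ hmem
      funext i
      fin_cases i
      · exact h0
      · exact (hdiag a₀ ha₀).symm.trans (h0.trans (hdiag b₀ hb₀))
    · obtain ⟨i, hi⟩ := (ne_univ_iff_exists_notMem Z).1 hZ
      refine ⟨fun _ => a (1 - i), ?_, fun j hj => ?_⟩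
      · fin_cases i
        · exact ha.2
        · exact ha.1
      · have : j ≠ i := by rintro rfl; exact hi hj
        have : j = 1 - i := by
          fin_cases i <;> fin_cases j <;> simp_all
        rw [this]
  refine hunb.not_step hgood ?_
  obtain ⟨X, _, S, p, hS, hp, hDS⟩ := hD
  have hmod : ∀ F : X ⊕ X → M, Models (Atom.map Sum.inl '' S ∪ Atom.map Sum.inr '' S) F ↔
      Models S (F ∘ Sum.inl) ∧ Models S (F ∘ Sum.inr) := by
    intro F
    rw [models_union, models_map, models_map]
  have h01 : p 0 ≠ p 1 := fun h => absurd (hp h) (by decide)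
  have hmem : ∀ f : X → M, Models S f → f ∘ p ∈ D := fun f hf => by rw [hDS]; exact ⟨f, hf, rfl⟩
  have hof : ∀ a ∈ D, ∃ f : X → M, Models S f ∧ f ∘ p = a := fun a ha => by rwa [hDS] at ha
  have heq : ∀ f : X → M, Models S f → f (p 0) = f (p 1) := fun f hf => hdiag _ (hmem f hf)
  -- Two independent copies of the atoms: the first coordinate stays fixed in one copy, and the
  -- second moves from `p 0` to `p 1` in the other. These two carry equal values in every solution,
  -- so the pair `(W, D)` is taken to itself.
  refine ⟨X ⊕ X, inferInstance, Atom.map Sum.inl '' S ∪ Atom.map Sum.inr '' S,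
    ![Sum.inr (p 0), Sum.inl (p 0)], ![Sum.inr (p 0), Sum.inl (p 1)],
    (hS.image _).union (hS.image _), ?_, ?_, ?_, ⟨1, ?_⟩, ?_, ?_, ?_, ?_⟩
  · simp [Injective, Fin.forall_fin_two]
  · simp [Injective, Fin.forall_fin_two]
  · simp [Fin.forall_fin_two, h01]
  · simpa using h01
  · ext a
    constructor
    · rintro ⟨h0, h1⟩
      obtain ⟨f0, hf0, hf0'⟩ := hof _ h0
      obtain ⟨f1, hf1, hf1'⟩ := hof _ h1
      refine ⟨Sum.elim f1 f0, (hmod _).2 ⟨hf1, hf0⟩, ?_⟩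
      funext i
      fin_cases i
      · exact congrFun hf0' 0
      · exact congrFun hf1' 0
    · rintro ⟨F, hF, rfl⟩
      obtain ⟨h1, h0⟩ := (hmod F).1 hF
      have k0 := hconst _ (hmem _ h0)
      have k1 := hconst _ (hmem _ h1)
      exact ⟨k0, k1⟩
  · ext a
    constructor
    · rintro ⟨h0, h1⟩
      obtain ⟨f0, hf0, hf0'⟩ := hof _ h0
      obtain ⟨f1, hf1, hf1'⟩ := hof _ h1
      refine ⟨Sum.elim f1 f0, (hmod _).2 ⟨hf1, hf0⟩, ?_⟩
      funext i
      fin_cases i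
      · exact congrFun hf0' 0
      · exact congrFun hf1' 1
    · rintro ⟨F, hF, rfl⟩
      obtain ⟨h1, h0⟩ := (hmod F).1 hF
      have k0 := hconst _ (hmem _ h0)
      have k1 := hconst _ (hmem _ h1)
      refine ⟨k0, ?_⟩
      change (fun _ => F (Sum.inl (p 1))) ∈ D
      rwa [← show F (Sum.inl (p 0)) = F (Sum.inl (p 1)) from heq _ h1]
  · intro F hF hFD
    obtain ⟨h1, h0⟩ := (hmod F).1 hF
    convert hFD using 1
    funext i
    fin_cases i
    · rfl
    · exact (heq _ h1).symm
  · intro a ha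
    obtain ⟨f, hf, rfl⟩ := hof a ha
    have hF : Models (Atom.map Sum.inl '' S ∪ Atom.map Sum.inr '' S) (Sum.elim f f) :=
      (hmod _).2 ⟨hf, hf⟩
    refine ⟨Sum.elim f f, hF, ?_, ?_⟩
    · convert hconst _ (hmem f hf) using 1
      funext i
      fin_cases i <;> rfl
    · funext i
      fin_cases i <;> rfl

end Equality

end FiniteDuality

namespace FiniteDuality

open Function Set
open FirstOrder.Language.Structure (RelMap)

universe u v u' v' w

/-! ### From minimal constraints to a homomorphism -/

section Solutions

variable {L : FirstOrder.Language.{u, v}} {L' : FirstOrder.Language.{u', v'}} {M : Type w}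
  [L.Structure M] [L'.Structure M]

/-- A `k`-subtuple is padded to length `k'` by repeating its last index, which exists as `k ≥ 1`. -/
theorem IsKHomogeneous.mono {k k' : ℕ} (hk : 1 ≤ k) (hkk' : k ≤ k') (h : IsKHomogeneous L M k) :
    IsKHomogeneous L M k' := by
  intro n a b hab
  refine h n a b fun i => ?_
  obtain ⟨σ, hσ⟩ := hab fun j => i ⟨min j (k - 1), by omega⟩
  refine ⟨σ, fun j => ?_⟩
  have := hσ (Fin.castLE hkk' j)
  have hj : min (j : ℕ) (k - 1) = j := by omega
  simpa [hj] using this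

theorem SameOrbit.relMap_iff {n : ℕ} {a b : Fin n → M} (h : SameOrbit L M a b)
    (A : L.Relations n) : RelMap A a ↔ RelMap A b := by
  obtain ⟨σ, hσ⟩ := h
  have : b = σ ∘ a := funext fun i => (hσ i).symm
  rw [this]
  exact (σ.map_rel A a).symm

theorem SameOrbit.eq_iff {n : ℕ} {a b : Fin n → M} (h : SameOrbit L M a b) (i j : Fin n) :
    a i = a j ↔ b i = b j := by
  obtain ⟨σ, hσ⟩ := h
  rw [← hσ, ← hσ, σ.injective.eq_iff]

/-- A local solution on `X` satisfies both constraints, so their conjunction is non-empty and, by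
minimality, equals `R X`. -/
theorem subset_of_subset [Nonempty M] {V : Type} [L'.Structure V] {R : Finset V → Set (V → M)}
    {k K : ℕ} (hR : ∀ X, X.card ≤ k → MinDef L' X (R X))
    (hne : ∀ Z : Finset V, Z.card ≤ K → (localSols L' k R Z).Nonempty) (hkK : k ≤ K)
    {X Y : Finset V} (hX : X.card ≤ k) (hYX : Y ⊆ X) : R X ⊆ R Y := by
  have hY := (Finset.card_le_card hYX).trans hX
  obtain ⟨g, hg⟩ := hne X (hX.trans hkK)
  have := (hR X hX).eq_of_subset _ inter_subset_left
    ((hR X hX).defOn.inter ((hR Y hY).defOn.mono hYX))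
    ⟨g, hg.2 X subset_rfl hX, hg.2 Y hYX hY⟩
  rw [← this]
  exact inter_subset_right

variable [Countable M] [Nonempty M] [L.IsRelational] [L'.IsRelational] {ι : L →ᴸ L'}
  {V : Type} [L'.Structure V] {R : Finset V → Set (V → M)} {k K : ℕ}

open Classical in
/-- Each minimal definable constraint on at most `k` variables is contained in one orbit. -/
theorem exists_aut_of_mem (hexp : IsFirstOrderExpansion ι M) (hcore : IsModelCompleteCore L M)
    (hfin : ∀ n, {R : Set (Fin n → M) | IsCQDefinable L' R}.Finite) (hunb : IsUnbalanced L' M)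
    (hR : ∀ X, X.card ≤ k → MinDef L' X (R X))
    (hne : ∀ Z : Finset V, Z.card ≤ K → (localSols L' k R Z).Nonempty) (hkK : k ≤ K) (hk : 2 ≤ k)
    {X : Finset V} (hX : X.card ≤ k) {g h : V → M} (hg : g ∈ R X) (hh : h ∈ R X) :
    ∃ σ : M ≃[L] M, ∀ x ∈ X, σ (g x) = h x := by
  have hinv := hexp.preservedByAut
  -- If two variables take equal values once, they always do: an automorphism cannot take distinct
  -- values to equal ones. The constraint then lies on the diagonal, so it has one value, which all
  -- automorphisms fix.
  have hpair : ∀ x y : V, x ≠ y → (∃ g ∈ R {x, y}, g x = g y) →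
      ∃ c, (∀ g ∈ R {x, y}, g x = c) ∧ ∀ σ : M ≃[L] M, σ c = c := by
    rintro x y hxy ⟨g, hg, hgxy⟩
    have hmin := hR {x, y} (Finset.card_le_two.trans hk)
    have hdiag : ∀ h ∈ R {x, y}, h x = h y := by
      intro h hh
      by_contra hne
      have hinj : InjOn h ({x, y} : Finset V) := by
        intro a ha b hb hab
        simp only [Finset.coe_insert, Finset.coe_singleton, mem_insert_iff, mem_singleton_iff]
          at ha hb
        rcases ha with rfl | rfl <;> rcases hb with rfl | rfl
        · rfl
        · exact absurd hab hne
        · exact absurd hab.symm hne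
        · rfl
      obtain ⟨σ, hσ⟩ := hmin.exists_aut_of_injOn hexp hcore hfin hh hg hinj
      rw [← hσ x (by simp), ← hσ y (by simp)] at hgxy
      exact hne (σ.injective hgxy)
    have hy : Enumerates ![x, y] {x, y} := by
      refine ⟨by simp [Injective, Fin.forall_fin_two, hxy, hxy.symm], ?_⟩
      simp [Matrix.range_cons, Set.pair_comm]
    have hsub := hunb.subsingleton_of_diagonal (hmin.defOn.pull hy) (by
      rintro _ ⟨h, hh, rfl⟩
      exact hdiag h hh)
    have hconst : ∀ h ∈ R {x, y}, h x = g x := fun h hh =>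
      congrFun (hsub ⟨h, hh, rfl⟩ ⟨g, hg, rfl⟩) 0
    exact ⟨g x, hconst, fun σ => hconst _ (hmin.defOn.comp_mem hinv σ hg)⟩
  -- The variables whose value under `g` is not shared with another variable. On these `g` is
  -- injective; on the rest the value is the fixed point given by `hpair`, which any automorphism
  -- respects.
  let X₁ := X.filter fun x => ∀ y ∈ X, y ≠ x → g y ≠ g x
  have hX₁X : X₁ ⊆ X := Finset.filter_subset _ _
  have hsub := subset_of_subset hR hne hkK hX hX₁X
  obtain ⟨σ, hσ⟩ := (hR X₁ ((Finset.card_le_card hX₁X).trans hX)).exists_aut_of_injOn hexp hcore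
    hfin (hsub hg) (hsub hh) (by
      intro a ha b hb hab
      by_contra hne
      exact (Finset.mem_filter.1 (Finset.mem_coe.1 hb)).2 a (hX₁X (Finset.mem_coe.1 ha)) hne hab)
  refine ⟨σ, fun x hx => ?_⟩
  by_cases hx₁ : x ∈ X₁
  · exact hσ x hx₁
  · have : ∃ y ∈ X, y ≠ x ∧ g y = g x := by
      by_contra! hall
      exact hx₁ (Finset.mem_filter.2 ⟨hx, hall⟩)
    obtain ⟨y, hy, hyx, hgyx⟩ := this
    have hxyX : ({x, y} : Finset V) ⊆ X := by
      intro z hz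
      rcases Finset.mem_insert.1 hz with rfl | hz
      · exact hx
      · exact Finset.mem_singleton.1 hz ▸ hy
    have hsub' := subset_of_subset hR hne hkK hX hxyX
    obtain ⟨c, hc, hσc⟩ := hpair x y hyx.symm ⟨g, hsub' hg, hgyx.symm⟩
    rw [hc g (hsub' hg), hc h (hsub' hh), hσc]

open Classical in
/-- The local solutions on at most `K` variables form one orbit. -/
theorem sameOrbit_of_mem_localSols (hexp : IsFirstOrderExpansion ι M)
    (hcore : IsModelCompleteCore L M)
    (hfin : ∀ n, {R : Set (Fin n → M) | IsCQDefinable L' R}.Finite) (hunb : IsUnbalanced L' M)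
    (hkhom : IsKHomogeneous L M k)
    (hR : ∀ X, X.card ≤ k → MinDef L' X (R X))
    (hne : ∀ Z : Finset V, Z.card ≤ K → (localSols L' k R Z).Nonempty) (hkK : k ≤ K) (hk : 2 ≤ k)
    {Z : Finset V} {g h : V → M} (hg : g ∈ localSols L' k R Z) (hh : h ∈ localSols L' k R Z)
    {r : ℕ} {x : Fin r → V} (hx : ∀ i, x i ∈ Z) : SameOrbit L M (g ∘ x) (h ∘ x) := by
  refine hkhom r _ _ fun i => ?_
  let X := Finset.univ.image (x ∘ i)
  have hX : X.card ≤ k := by simpa using Finset.card_image_le (s := Finset.univ) (f := x ∘ i)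
  have hXZ : X ⊆ Z := by
    intro z hz
    obtain ⟨j, -, rfl⟩ := Finset.mem_image.1 hz
    exact hx _
  obtain ⟨σ, hσ⟩ := exists_aut_of_mem hexp hcore hfin hunb hR hne hkK hk hX
    (hg.2 X hXZ hX) (hh.2 X hXZ hX)
  exact ⟨σ, fun j => hσ _ (Finset.mem_image_of_mem _ (Finset.mem_univ j))⟩

open Classical in
/-- Minimal constraints on at most `k` variables that are locally satisfiable on sufficiently large
sets give a homomorphism. -/
theorem HasLevel.nonempty_hom [Finite V] (hexp : IsFirstOrderExpansion ι M)
    (hhom : L.IsUltrahomogeneous M) (hcore : IsModelCompleteCore L M)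
    (hfin : ∀ n, {R : Set (Fin n → M) | IsCQDefinable L' R}.Finite) (hunb : IsUnbalanced L' M)
    (hkhom : IsKHomogeneous L M k) {ℓ : ℕ} (hbdd : IsLBounded L M ℓ) (hkK : k ≤ K) (hk : 2 ≤ k)
    (hK3 : 3 ≤ K) (hℓK : ℓ ≤ K) (hLK : ∀ r, L.Relations r → 2 * r ≤ K)
    (hL'K : ∀ r, L'.Relations r → r ≤ K) (h : HasLevel L' M V k K) : Nonempty (V →[L'] M) := by
  obtain ⟨R, hR, hne⟩ := h
  have horb : ∀ {Z : Finset V} {g h : V → M}, g ∈ localSols L' k R Z → h ∈ localSols L' k R Z →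
      ∀ {r : ℕ} {x : Fin r → V}, (∀ i, x i ∈ Z) → SameOrbit L M (g ∘ x) (h ∘ x) :=
    fun hg hh _ _ hx => sameOrbit_of_mem_localSols hexp hcore hfin hunb hkhom hR hne hkK hk hg hh hx
  have himage : ∀ {r : ℕ} (x : Fin r → V), (Finset.univ.image x).card ≤ r := fun x => by
    simpa using Finset.card_image_le (s := Finset.univ) (f := x)
  have hmemimage : ∀ {r : ℕ} (x : Fin r → V) (i : Fin r), x i ∈ Finset.univ.image x :=
    fun x i => Finset.mem_image_of_mem x (Finset.mem_univ i)
  have hpairK : ∀ x y : V, ({x, y} : Finset V).card ≤ K := fun x y =>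
    Finset.card_le_two.trans (by omega)
  -- two variables are identified if their values are equal in the local solutions
  let E : V → V → Prop := fun x y => ∀ g ∈ localSols L' k R {x, y}, g x = g y
  have hE : ∀ {Z : Finset V} {g : V → M}, g ∈ localSols L' k R Z → ∀ {x y : V}, x ∈ Z → y ∈ Z →
      (E x y ↔ g x = g y) := by
    intro Z g hg x y hx hy
    have hsub : ({x, y} : Finset V) ⊆ Z := by
      intro z hz
      rcases Finset.mem_insert.1 hz with rfl | hz
      · exact hx
      · exact Finset.mem_singleton.1 hz ▸ hy
    have hg' := localSols_anti hsub hg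
    refine ⟨fun h => h g hg', fun h g' hg'' => ?_⟩
    have := (horb hg' hg'' (x := ![x, y]) (by simp [Fin.forall_fin_two])).eq_iff 0 1
    exact this.1 h
  let s : Setoid V :=
    { r := E
      iseqv :=
        { refl := fun x g _ => rfl
          symm := by
            intro x y h g hg
            rw [Finset.pair_comm] at hg
            exact (h g hg).symm
          trans := by
            intro x y z hxy hyz
            obtain ⟨g, hg⟩ := hne {x, y, z} (Finset.card_le_three.trans hK3)
            rw [hE hg (by simp) (by simp)] at hxy hyz ⊢
            exact hxy.trans hyz } }
  let X := Quotient s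
  let mk : V → X := Quotient.mk s
  let out : X → V := Quotient.out
  have hmk : ∀ x y, mk x = mk y ↔ E x y := fun x y => Quotient.eq (r := s)
  have hmkout : ∀ x, mk (out x) = x := fun x => Quotient.out_eq x
  -- Relations on the quotient are read off a local solution on chosen representatives; neither
  -- choice matters, as `hrel` shows.
  let : L.Structure X :=
    { funMap := fun f => isEmptyElim f
      RelMap := fun {r} A x =>
        ∃ g ∈ localSols L' k R (Finset.univ.image (out ∘ x)), RelMap A (g ∘ out ∘ x) }
  have hrel : ∀ {r : ℕ} (A : L.Relations r) {Z : Finset V} {g : V → M},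
      g ∈ localSols L' k R Z → ∀ {z : Fin r → V}, (∀ i, z i ∈ Z) →
      (RelMap A (mk ∘ z) ↔ RelMap A (g ∘ z)) := by
    intro r A Z g hg z hz
    let x := out ∘ mk ∘ z
    -- A tuple and its representatives are compared inside one local solution, which is why `K` must
    -- be at least twice each arity in `L`.
    let Z' := Finset.univ.image z ∪ Finset.univ.image x
    have hZ' : Z'.card ≤ K := by
      have h1 := himage z
      have h2 := himage x
      have h3 := hLK r A
      exact (Finset.card_union_le _ _).trans (by omega)
    obtain ⟨h, hh⟩ := hne Z' hZ'
    have hhx : h ∘ x = h ∘ z := by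
      funext i
      refine (hE hh (Finset.mem_union_right _ (hmemimage x i))
        (Finset.mem_union_left _ (hmemimage z i))).1 ?_
      rw [← hmk]
      exact hmkout _
    have hzg : RelMap A (h ∘ z) ↔ RelMap A (g ∘ z) := by
      refine (horb (Z := Finset.univ.image z) (localSols_anti Finset.subset_union_left hh)
        (localSols_anti ?_ hg) (hmemimage z)).relMap_iff A
      intro v hv
      obtain ⟨i, -, rfl⟩ := Finset.mem_image.1 hv
      exact hz i
    have hhx' := localSols_anti (Finset.subset_union_right (s₁ := Finset.univ.image z)) hh
    rw [← hzg, ← hhx]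
    constructor
    · rintro ⟨g', hg', hA⟩
      exact ((horb hg' hhx' (hmemimage x)).relMap_iff A).1 hA
    · intro hA
      exact ⟨h, hhx', hA⟩
  have hembed : Nonempty (X ↪[L] M) := by
    -- A local solution on the representatives of `Y` embeds `Y`, since it reflects both
    -- identification and the relations.
    refine hbdd X fun Y hY => ?_
    have : Finite Y := Subtype.finite
    let Z : Finset V := (Set.toFinite (range fun y : Y => out y)).toFinset
    have hZ : Z.card ≤ K := by
      rw [← Set.ncard_eq_toFinset_card]
      exact (Finite.card_range_le (fun y : Y => out y)).trans (hY.trans hℓK)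
    have hmemZ : ∀ y : Y, out y ∈ Z := fun y => by simp [Z]
    obtain ⟨g, hg⟩ := hne Z hZ
    refine ⟨{ toFun := fun y => g (out y)
              inj' := ?_
              map_fun' := fun f => isEmptyElim f
              map_rel' := ?_ }⟩
    · intro y y' hyy'
      have := (hE hg (hmemZ y) (hmemZ y')).2 hyy'
      rw [← hmk, hmkout, hmkout] at this
      exact Subtype.ext this
    · intro r A y
      have h1 := hrel A hg (z := fun i => out (y i)) (fun i => hmemZ _)
      have h2 : (mk ∘ fun i => out (y i)) = fun i => (y i : X) := funext fun i => hmkout _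
      rw [h2] at h1
      exact h1.symm
  obtain ⟨ε⟩ := hembed
  refine ⟨{ toFun := fun v => ε (mk v), map_fun' := fun f => isEmptyElim f, map_rel' := ?_ }⟩
  intro r A x hx
  obtain ⟨g, hg⟩ := hne (Finset.univ.image x) ((himage x).trans (hL'K r A))
  have hsame : SameOrbit L M (g ∘ x) ((fun v => ε (mk v)) ∘ x) := by
    -- Both tuples have the atomic type prescribed by the quotient, so by homogeneity they share an
    -- orbit, and the relation that holds for `g ∘ x` is transferred.
    refine exists_aut_of_same_type hhom (fun i j => ?_) fun r' B y => ?_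
    · simp only [comp_apply]
      rw [ε.injective.eq_iff, hmk, hE hg (hmemimage x i) (hmemimage x j)]
    · have h1 := hrel B hg (z := x ∘ y) (fun i => hmemimage x _)
      have h2 := ε.map_rel B (mk ∘ x ∘ y)
      exact h1.symm.trans h2.symm
  obtain ⟨σ, hσ⟩ := hsame
  have h1 : (fun v => ε (mk v)) ∘ x = σ ∘ g ∘ x := funext fun i => (hσ i).symm
  rw [h1]
  exact hexp.preservedByAut σ r A _ (hg.1 r A x (hmemimage x) hx)

end Solutions

/-! ### Finite obstruction sets from local solvability -/

section Obstructions

variable {L : FirstOrder.Language.{u, v}} {M : Type w} [L.Structure M]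

theorem finite_structure [L.IsRelational] [Finite (Σ r, L.Relations r)] (n : ℕ) :
    Finite (L.Structure (Fin n)) := by
  let f : L.Structure (Fin n) → Set (Σ A : (Σ r, L.Relations r), Fin A.1 → Fin n) :=
    fun S => {p | S.RelMap p.1.2 p.2}
  refine Finite.of_injective f fun S T h => ?_
  ext r
  · rename_i F x
    exact isEmptyElim F
  · rename_i A x
    exact Set.ext_iff.1 h ⟨⟨r, A⟩, x⟩

/-- A cylinder over `∅` is empty or everything, so the trivial constraint is already minimal and
level zero is plain local solvability. -/
theorem hasLevel_zero {V : Type} [L.Structure V] [Nonempty M] {N : ℕ}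
    (h : ∀ Z : Finset V, Z.card ≤ N → ∃ g : V → M, ∀ (r : ℕ) (A : L.Relations r) (x : Fin r → V),
      (∀ i, x i ∈ Z) → RelMap A x → RelMap A (g ∘ x)) : HasLevel L M V 0 N := by
  refine ⟨fun _ => univ, fun X hX => ⟨defOn_univ X, univ_nonempty, fun H _ hH hne => ?_⟩,
    fun Z hZ => ?_⟩
  · obtain rfl : X = ∅ := Finset.card_eq_zero.1 (Nat.le_zero.1 hX)
    obtain ⟨g, hg⟩ := hne
    exact eq_univ_of_forall fun k => hH.isCyl (by simp) hg
  · obtain ⟨g, hg⟩ := h Z hZ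
    exact ⟨g, hg, fun _ _ _ => trivial⟩

theorem exists_hasLevel [Nonempty M] [Finite (Σ r, L.Relations r)] (hunb : IsUnbalanced L M)
    (hfin : ∀ n, {R : Set (Fin n → M) | IsCQDefinable L R}.Finite) (m K : ℕ) :
    ∃ N, ∀ (V : Type) [Finite V] [L.Structure V], HasLevel L M V 0 N → HasLevel L M V m K := by
  induction m generalizing K with
  | zero => exact ⟨K, fun _ _ _ h => h⟩
  | succ m ih =>
    -- The maximum meets the requirement `m + 1 ≤ K` of `HasLevel.succ_of_le`.
    obtain ⟨N, hN⟩ := ih (max K (m + 1) + 2 ^ max K (m + 1) *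
      BagTree.varBound {R : Set (Fin (m + 1) → M) | IsCQDefinable L R}.ncard (max K (m + 1))
        ((definablePairs L M (m + 1)).ncard + 1))
    refine ⟨N, fun V _ _ h => ?_⟩
    exact ((hN V h).succ_of_le hunb (hfin _) (le_max_right _ _)).mono (le_max_left _ _)

/-- A structure has finite duality as soon as local solvability implies solvability. -/
theorem hasFiniteDuality_of_local [L.IsRelational] [Finite (Σ r, L.Relations r)] [Nonempty M]
    {N : ℕ}
    (h : ∀ (V : Type) [Finite V] [L.Structure V], HasLevel L M V 0 N → Nonempty (V →[L] M)) :
    HasFiniteDuality L M := by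
  let O : Set (Σ n : ℕ, L.Structure (Fin n)) :=
    {D | D.1 ≤ N ∧ ¬ Nonempty (@FirstOrder.Language.Hom L (Fin D.1) M D.2 _)}
  refine ⟨O, ?_, fun C _ _ => ⟨?_, fun hC => h C (hasLevel_zero fun Z hZ => ?_)⟩⟩
  · have : ∀ n, Finite (L.Structure (Fin n)) := finite_structure
    refine ((Set.finite_Iic N).biUnion fun n _ =>
      (Set.finite_range (Sigma.mk (β := fun n => L.Structure (Fin n)) n))).subset ?_
    rintro ⟨n, D⟩ ⟨hn, -⟩
    exact mem_biUnion (mem_Iic.2 hn) (mem_range_self D)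
  · rintro ⟨f⟩ ⟨n, D⟩ hD ⟨d⟩
    let := D
    exact hD.2 ⟨f.comp d⟩
  · classical
    let e := Z.equivFin
    let D : L.Structure (Fin Z.card) :=
      { funMap := fun f => isEmptyElim f
        RelMap := fun A x => RelMap A (fun i => (e.symm (x i) : C)) }
    have hD : ¬ (⟨Z.card, D⟩ : Σ n : ℕ, L.Structure (Fin n)) ∈ O := by
      intro hD
      exact hC _ hD ⟨{ toFun := fun i => (e.symm i : C)
                       map_fun' := fun f => isEmptyElim f
                       map_rel' := fun A x hx => hx }⟩
    have : Nonempty (Fin Z.card →[L] M) := by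
      by_contra hno
      exact hD ⟨hZ, hno⟩
    obtain ⟨f⟩ := this
    refine ⟨fun v => if hv : v ∈ Z then f (e ⟨v, hv⟩) else Classical.arbitrary M, ?_⟩
    intro r A x hx hA
    have h1 : RelMap A (fun i => e ⟨x i, hx i⟩) := by
      change RelMap A (fun i => (e.symm (e ⟨x i, hx i⟩) : C))
      simpa using hA
    have h2 := f.map_rel A _ h1
    convert h2 using 1
    funext i
    simp [hx i]

end Obstructions

end FiniteDuality

theorem proposition4
    (L L' : FirstOrder.Language) [L.IsRelational] [L'.IsRelational] [Finite L'.Symbols]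
    (ι : L →ᴸ L') (M : Type*) [Countable M] [Nonempty M] [L.Structure M] [L'.Structure M]
    (k ℓ : ℕ) (hk : 1 ≤ k) (hℓ : 1 ≤ ℓ)
    (hhom : L.IsUltrahomogeneous M)
    (hkhom : FiniteDuality.IsKHomogeneous L M k)
    (hbdd : FiniteDuality.IsLBounded L M ℓ)
    (hcore : FiniteDuality.IsModelCompleteCore L M)
    (hexp : FiniteDuality.IsFirstOrderExpansion ι M)
    (hunb : FiniteDuality.IsUnbalanced L' M)
    (heq : FiniteDuality.IsEqualityFree L' M) :
    FiniteDuality.HasFiniteDuality L' M := by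
  have hL' : Finite (Σ r, L'.Relations r) :=
    Finite.of_injective (β := L'.Symbols) Sum.inr Sum.inr_injective
  have hL : Finite (Σ r, L.Relations r) := by
    refine Finite.of_injective (β := Σ r, L'.Relations r)
      (fun A => ⟨A.1, ι.onRelation A.2⟩) ?_
    rintro ⟨r, A⟩ ⟨s, B⟩ h
    simp only [Sigma.mk.injEq] at h
    obtain ⟨rfl, h⟩ := h
    exact congrArg (Sigma.mk r) (hexp.injective.onRelation (eq_of_heq h))
  have hfin := FiniteDuality.finite_isCQDefinable hhom hexp.preservedByAut
  obtain ⟨b, hb⟩ := (Set.finite_range fun A : (Σ r, L'.Relations r) => A.1).bddAbove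
  have hb' : ∀ r, L'.Relations r → r ≤ b := fun r A => hb ⟨⟨r, A⟩, rfl⟩
  -- Large enough for the constrained sets, the triples that give transitivity of identification,
  -- the `ℓ`-element substructures, and two tuples related by a symbol. The level `max k 2` is at
  -- least `2` so that pairs of variables are constrained.
  let K := max k 2 + 3 + ℓ + 2 * b
  obtain ⟨N, hN⟩ := FiniteDuality.exists_hasLevel hunb hfin (max k 2) K
  refine FiniteDuality.hasFiniteDuality_of_local (N := N) fun V _ _ hV => ?_
  refine (hN V hV).nonempty_hom hexp hhom hcore hfin hunb (hkhom.mono hk (le_max_left k 2)) hbdd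
    (by omega) (le_max_right k 2) (by omega) (by omega) (fun r A => ?_) (fun r A => ?_)
  · have := hb' r (ι.onRelation A)
    omega
  · have := hb' r A
    omega
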